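/- Let $q$ be a real number with $0<|q|<1$. Let $\mathcal H=L_2(\mathbb N)\otimes L_2(\mathbb Z)$ with orthonormal basis $e_{ij}$ ($i\in\mathbb N=\{0,1,2,\dots\}$, $j\in\mathbb Z$), and let $\alpha,\beta$ be the bounded operators $$\alpha e_{ij}=\sqrt{1-q^{2i}}\,e_{i-1,j}\ (i\ge 1),\qquad \alpha e_{0j}=0,\qquad \beta e_{ij}=q^{i}e_{i,j-1}.$$ Let $\mathcal A_f$ be the unital $*$-algebra of operators generated by $\alpha$ and $\beta$, and let $\mathcal I_\beta$ be the two-sided ideal of $\mathcal A_f$ generated by $\beta$ and $\beta^*$. Let $I\otimes S$ be the operator with $(I\otimes S)e_{ij}=e_{ij}$ for $j\ge 0$ and $(I\otimes S)e_{ij}=-e_{ij}$ for $j<0$, and let $D=N\otimes S+I\otimes N$ be the self-adjoint operator with $De_{ij}=(i+j)e_{ij}$ for $j\ge0$ and $De_{ij}=(-i+j)e_{ij}$ for $j<0$. For $a\in\mathcal A_f$ the operator $a$ preserves the domain of $D$ and $[D,a]$ extends to a bounded operator, denoted by $[D,a]$ as well. Let $(\Omega^\bullet(\mathcal A_f),\delta)$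 be the universal graded differential algebra of the unital complex algebra $\mathcal A_f$, so that $\Omega^n(\mathcal A_f)$ is spanned by the forms $a_0(\delta a_1)\cdots(\delta a_n)$. Let $\theta:\mathcal L(\mathcal H)\to\mathcal Q(\mathcal H)=\mathcal L(\mathcal H)/\mathcal K(\mathcal H)$ be the projection onto the Calkin algebra, and let $\psi:\Omega^\bullet(\mathcal A_f)\to\mathcal Q(\mathcal H)$ be the algebra homomorphism $$\psi\bigl(a_0(\delta a_1)\cdots(\delta a_n)\bigr)=\theta\bigl(a_0[D,a_1]\cdots[D,a_n]\bigr).$$ Put $J_n=\{\omega\in\Omega^n(\mathcal A_f):\psi(\omega)=0\}$, $J_{-1}=0$, and $$\Omega^n_d(\mathcal A_f)=\Omega^n(\mathcal A_f)/(J_n+\delta J_{n-1}),$$ which is an $\mathcal A_f$-bimodule. **Theorem.** (i) There is an isomorphism of $\mathcal A_f$-bimodules $\Phi:\Omega^1_d(\mathcal A_f)\to\mathcal A_f\oplus\mathcal I_\beta$ such that, for every $\omega\in\Omega^1(\mathcal A_f)$ with class $[\omega]\in\Omega_d^1(\mathcal A_f)$, if $\Phi([\omega])=(b,c)$, then $\psi(\omega)=\theta\bigl((I\otimes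 S)\,b+c\bigr)$. (ii) $\Omega^n_d(\mathcal A_f)=\{0\}$ for all $n\ge 2$. -/

import Mathlib

open scoped ENNReal

noncomputable section

namespace ConnesDeRham

/-! ### The universal graded differential algebra of a unital complex algebra -/

section Universal

/-- The relations of the universal differential graded algebra over `A`. Its generators are
the symbols `a` (`Sum.inl a`) and `δ a` (`Sum.inr a`), for `a ∈ A`. The relations say that
`a ↦ a` is a homomorphism of unital algebras, that `δ` is linear,
and that `δ (ab) = a (δ b) + (δ a) b`. -/
inductive UnivRel (A : Type*) [Ring A] [Algebra ℂ A] :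
    FreeAlgebra ℂ (A ⊕ A) → FreeAlgebra ℂ (A ⊕ A) → Prop
  | gen_scalar (c : ℂ) : UnivRel A (FreeAlgebra.ι ℂ (Sum.inl (algebraMap ℂ A c)))
      (algebraMap ℂ (FreeAlgebra ℂ (A ⊕ A)) c)
  | gen_add (a b : A) : UnivRel A (FreeAlgebra.ι ℂ (Sum.inl (a + b)))
      (FreeAlgebra.ι ℂ (Sum.inl a) + FreeAlgebra.ι ℂ (Sum.inl b))
  | gen_mul (a b : A) : UnivRel A (FreeAlgebra.ι ℂ (Sum.inl (a * b)))
      (FreeAlgebra.ι ℂ (Sum.inl a) * FreeAlgebra.ι ℂ (Sum.inl b))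
  | d_add (a b : A) : UnivRel A (FreeAlgebra.ι ℂ (Sum.inr (a + b)))
      (FreeAlgebra.ι ℂ (Sum.inr a) + FreeAlgebra.ι ℂ (Sum.inr b))
  | d_smul (c : ℂ) (a : A) : UnivRel A (FreeAlgebra.ι ℂ (Sum.inr (c • a)))
      (c • FreeAlgebra.ι ℂ (Sum.inr a))
  | d_mul (a b : A) : UnivRel A (FreeAlgebra.ι ℂ (Sum.inr (a * b)))
      (FreeAlgebra.ι ℂ (Sum.inl a) * FreeAlgebra.ι ℂ (Sum.inr b) +
        FreeAlgebra.ι ℂ (Sum.inr a) * FreeAlgebra.ι ℂ (Sum.inl b))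

/-- The universal differential graded algebra `Ω(A)`. -/
def UnivForms (A : Type*) [Ring A] [Algebra ℂ A] : Type _ := RingQuot (UnivRel A)

instance (A : Type*) [Ring A] [Algebra ℂ A] : Ring (UnivForms A) :=
  inferInstanceAs (Ring (RingQuot (UnivRel A)))

instance (A : Type*) [Ring A] [Algebra ℂ A] : Algebra ℂ (UnivForms A) :=
  inferInstanceAs (Algebra ℂ (RingQuot (UnivRel A)))

namespace UnivForms

variable {A : Type*} [Ring A] [Algebra ℂ A] {B : Type*} [Ring B] [Algebra ℂ B]

/-- The quotient map from the free algebra. -/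
def mkHom (A : Type*) [Ring A] [Algebra ℂ A] : FreeAlgebra ℂ (A ⊕ A) →ₐ[ℂ] UnivForms A :=
  RingQuot.mkAlgHom ℂ (UnivRel A)

theorem mkHom_rel {x y : FreeAlgebra ℂ (A ⊕ A)} (h : UnivRel A x y) :
    mkHom A x = mkHom A y := RingQuot.mkAlgHom_rel ℂ h

/-- The canonical homomorphism `A → Ω(A)`, `a ↦ a`. -/
def of : A →ₐ[ℂ] UnivForms A where
  toFun a := mkHom A (FreeAlgebra.ι ℂ (Sum.inl a))
  map_one' := by
    have := mkHom_rel (UnivRel.gen_scalar (A := A) 1)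
    simpa using this
  map_mul' a b := by simpa using mkHom_rel (UnivRel.gen_mul a b)
  map_zero' := by
    have := mkHom_rel (UnivRel.gen_scalar (A := A) 0)
    simpa using this
  map_add' a b := by simpa using mkHom_rel (UnivRel.gen_add a b)
  commutes' c := by simpa using mkHom_rel (UnivRel.gen_scalar (A := A) c)

/-- The map `A → Ω(A)`, `a ↦ δ a`. -/
def dgen : A →ₗ[ℂ] UnivForms A where
  toFun a := mkHom A (FreeAlgebra.ι ℂ (Sum.inr a))
  map_add' a b := by simpa using mkHom_rel (UnivRel.d_add a b)
  map_smul' c a := by simpa using mkHom_rel (UnivRel.d_smul c a)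

theorem dgen_mul (a b : A) : dgen (a * b) = of a * dgen b + dgen a * of b := by
  simpa [of, dgen] using mkHom_rel (UnivRel.d_mul a b)

/-- The algebra homomorphism on `Ω(A)` with `a ↦ f a` and `δ a ↦ g a`. -/
def lift (f : A →ₐ[ℂ] B) (g : A →ₗ[ℂ] B)
    (h : ∀ a b, g (a * b) = f a * g b + g a * f b) : UnivForms A →ₐ[ℂ] B :=
  RingQuot.liftAlgHom ℂ ⟨FreeAlgebra.lift ℂ (Sum.elim f g), by
    intro x y hxy
    induction hxy <;> simp [h]⟩

theorem lift_mkHom (f : A →ₐ[ℂ] B) (g : A →ₗ[ℂ] B)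
    (h : ∀ a b, g (a * b) = f a * g b + g a * f b) (x : FreeAlgebra ℂ (A ⊕ A)) :
    lift f g h (mkHom A x) = FreeAlgebra.lift ℂ (Sum.elim f g) x := by
  unfold lift mkHom
  exact RingQuot.liftAlgHom_mkAlgHom_apply _ _ _ _

@[simp] theorem lift_of (f : A →ₐ[ℂ] B) (g : A →ₗ[ℂ] B)
    (h : ∀ a b, g (a * b) = f a * g b + g a * f b) (a : A) :
    lift f g h (of a) = f a := by
  change lift f g h (mkHom A _) = _
  simp [lift_mkHom]

@[simp] theorem lift_dgen (f : A →ₐ[ℂ] B) (g : A →ₗ[ℂ] B)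
    (h : ∀ a b, g (a * b) = f a * g b + g a * f b) (a : A) :
    lift f g h (dgen a) = g a := by
  change lift f g h (mkHom A _) = _
  simp [lift_mkHom]

@[elab_as_elim]
theorem induction {P : UnivForms A → Prop} (hof : ∀ a, P (of a)) (hd : ∀ a, P (dgen a))
    (hadd : ∀ x y, P x → P y → P (x + y)) (hmul : ∀ x y, P x → P y → P (x * y))
    (x : UnivForms A) : P x := by
  obtain ⟨y, rfl⟩ : ∃ y, mkHom A y = x := RingQuot.mkAlgHom_surjective ℂ _ x
  induction y using FreeAlgebra.induction with
  | grade0 c => rw [AlgHom.commutes, ← of.commutes]; exact hof _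
  | grade1 a =>
    cases a with
    | inl a => exact hof a
    | inr a => exact hd a
  | mul a b ha hb => rw [map_mul]; exact hmul _ _ ha hb
  | add a b ha hb => rw [map_add]; exact hadd _ _ ha hb

/-- The grading automorphism of `Ω(A)`: it is `(-1)ⁿ` in degree `n`. -/
def parity : UnivForms A →ₐ[ℂ] UnivForms A :=
  lift of (-dgen) (by
    intro a b
    simp only [LinearMap.neg_apply, dgen_mul, mul_neg, neg_mul]
    abel)

/-- The homomorphism `ω ↦ !![parity ω, δ ω; 0, ω]`, which encodes the graded Leibniz rule. -/
def deltaHom : UnivForms A →ₐ[ℂ] Matrix (Fin 2) (Fin 2) (UnivForms A) :=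
  lift
    { toFun := fun a => !![of a, dgen a; 0, of a]
      map_one' := by
        have h : dgen (1 : A) = 0 := by
          have := dgen_mul (1 : A) 1
          simpa using this
        ext i j; fin_cases i <;> fin_cases j <;> simp [h]
      map_mul' := fun a b => by
        ext i j; fin_cases i <;> fin_cases j <;> simp [dgen_mul]
      map_zero' := by ext i j; fin_cases i <;> fin_cases j <;> simp
      map_add' := fun a b => by ext i j; fin_cases i <;> fin_cases j <;> simp
      commutes' := fun c => by
        have h1 : dgen (1 : A) = 0 := by
          have := dgen_mul (1 : A) 1
          simpa using this
        have h : dgen (algebraMap ℂ A c) = 0 := by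
          rw [Algebra.algebraMap_eq_smul_one, map_smul, h1, smul_zero]
        ext i j; fin_cases i <;> fin_cases j <;> simp [h, Matrix.algebraMap_matrix_apply] }
    { toFun := fun a => !![-dgen a, 0; 0, dgen a]
      map_add' := fun a b => by
        ext i j; fin_cases i <;> fin_cases j <;> simp [add_comm]
      map_smul' := fun c a => by ext i j; fin_cases i <;> fin_cases j <;> simp }
    (by
      intro a b
      ext i j; fin_cases i <;> fin_cases j <;> simp [dgen_mul, add_comm])

/-- The differential `δ : Ω(A) → Ω(A)`, determined by `δ (of a) = dgen a`, `δ (dgen a) = 0` and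
the graded Leibniz rule. -/
def delta : UnivForms A →ₗ[ℂ] UnivForms A where
  toFun ω := deltaHom ω 0 1
  map_add' x y := by simp
  map_smul' c x := by simp

theorem deltaHom_eq (ω : UnivForms A) : deltaHom ω = !![parity ω, delta ω; 0, ω] := by
  suffices h : deltaHom ω 0 0 = parity ω ∧ deltaHom ω 1 0 = 0 ∧ deltaHom ω 1 1 = ω by
    obtain ⟨h1, h2, h3⟩ := h
    ext i j; fin_cases i <;> fin_cases j <;> simp [h1, h2, h3, delta]
  induction ω using UnivForms.induction with
  | hof a => simp [deltaHom, parity]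
  | hd a => simp [deltaHom, parity]
  | hadd x y hx hy => simp [hx, hy]
  | hmul x y hx hy => simp [hx, hy, Matrix.mul_apply, Fin.sum_univ_two]

@[simp] theorem delta_of (a : A) : delta (of a) = dgen a := by
  change deltaHom (of a) 0 1 = _
  simp [deltaHom]

@[simp] theorem delta_dgen (a : A) : delta (dgen a) = 0 := by
  change deltaHom (dgen a) 0 1 = _
  simp [deltaHom]

theorem delta_mul (x y : UnivForms A) :
    delta (x * y) = parity x * delta y + delta x * y := by
  change deltaHom (x * y) 0 1 = _
  rw [map_mul, deltaHom_eq, deltaHom_eq]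
  simp [Matrix.mul_apply, Fin.sum_univ_two]

@[simp] theorem parity_of (a : A) : parity (of a) = of a := by simp [parity]

@[simp] theorem parity_dgen (a : A) : parity (dgen a) = -dgen a := by simp [parity]

/-- `Ωⁿ(A)`, the linear span of the forms `a₀ (δ a₁) ⋯ (δ aₙ)`. -/
def deg (A : Type*) [Ring A] [Algebra ℂ A] (n : ℕ) : Submodule ℂ (UnivForms A) :=
  Submodule.span ℂ {ω | ∃ (a₀ : A) (a : Fin n → A),
    ω = of a₀ * (List.ofFn fun i => dgen (a i)).prod}

theorem of_mul_mem_deg (a : A) {n : ℕ} {ω : UnivForms A} (h : ω ∈ deg A n) :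
    of a * ω ∈ deg A n := by
  induction h using Submodule.span_induction with
  | mem x hx =>
    obtain ⟨a₀, b, rfl⟩ := hx
    refine Submodule.subset_span ⟨a * a₀, b, ?_⟩
    rw [map_mul, mul_assoc]
  | zero => simp
  | add x y _ _ hx hy => rw [mul_add]; exact add_mem hx hy
  | smul c x _ hx => rw [mul_smul_comm]; exact Submodule.smul_mem _ _ hx

theorem mul_dgen_mem_deg (a : A) {n : ℕ} {ω : UnivForms A} (h : ω ∈ deg A n) :
    ω * dgen a ∈ deg A (n + 1) := by
  induction h using Submodule.span_induction with
  | mem x hx =>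
    obtain ⟨a₀, b, rfl⟩ := hx
    refine Submodule.subset_span ⟨a₀, Fin.snoc b a, ?_⟩
    rw [List.ofFn_succ']
    simp [mul_assoc]
  | zero => simp
  | add x y _ _ hx hy => rw [add_mul]; exact add_mem hx hy
  | smul c x _ hx => rw [smul_mul_assoc]; exact Submodule.smul_mem _ _ hx

theorem deg_succ_induction {n : ℕ} {P : UnivForms A → Prop} (h0 : P 0)
    (hadd : ∀ x y, P x → P y → P (x + y)) (hsmul : ∀ (c : ℂ) x, P x → P (c • x))
    (hmul : ∀ x ∈ deg A n, ∀ a, P (x * dgen a)) {ω : UnivForms A} (h : ω ∈ deg A (n + 1)) :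
    P ω := by
  induction h using Submodule.span_induction with
  | mem x hx =>
    obtain ⟨a₀, b, rfl⟩ := hx
    rw [List.ofFn_succ']
    simp only [List.concat_eq_append, List.prod_append, List.prod_cons, List.prod_nil, mul_one,
      ← mul_assoc]
    exact hmul _ (Submodule.subset_span ⟨a₀, fun i => b i.castSucc, rfl⟩) _
  | zero => exact h0
  | add x y _ _ hx hy => exact hadd x y hx hy
  | smul c x _ hx => exact hsmul c x hx

theorem mem_deg_zero {ω : UnivForms A} : ω ∈ deg A 0 ↔ ∃ a, of a = ω := by
  constructor
  · intro h
    induction h using Submodule.span_induction with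
    | mem x hx => obtain ⟨a₀, b, rfl⟩ := hx; exact ⟨a₀, by simp⟩
    | zero => exact ⟨0, map_zero _⟩
    | add x y _ _ hx hy =>
      obtain ⟨a, rfl⟩ := hx
      obtain ⟨b, rfl⟩ := hy
      exact ⟨a + b, map_add _ _ _⟩
    | smul c x _ hx => obtain ⟨a, rfl⟩ := hx; exact ⟨c • a, map_smul _ _ _⟩
  · rintro ⟨a, rfl⟩
    exact Submodule.subset_span ⟨a, Fin.elim0, by simp⟩

theorem mul_of_mem_deg (a : A) {n : ℕ} : ∀ {ω : UnivForms A}, ω ∈ deg A n →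
    ω * of a ∈ deg A n := by
  induction n generalizing a with
  | zero =>
    intro ω h
    obtain ⟨b, rfl⟩ := mem_deg_zero.1 h
    exact mem_deg_zero.2 ⟨b * a, map_mul _ _ _⟩
  | succ n ih =>
    intro ω h
    refine deg_succ_induction (P := fun ω => ω * of a ∈ deg A (n + 1)) ?_ ?_ ?_ ?_ h
    · simp
    · intro x y hx hy; rw [add_mul]; exact add_mem hx hy
    · intro c x hx; rw [smul_mul_assoc]; exact Submodule.smul_mem _ _ hx
    · intro x hx b
      have : x * dgen b * of a = x * dgen (b * a) - x * of b * dgen a := by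
        rw [dgen_mul]; noncomm_ring
      rw [this]
      exact sub_mem (mul_dgen_mem_deg _ hx) (mul_dgen_mem_deg _ (ih b hx))

theorem parity_eq {n : ℕ} : ∀ {ω : UnivForms A}, ω ∈ deg A n →
    parity ω = (-1 : ℂ) ^ n • ω := by
  induction n with
  | zero =>
    intro ω h
    obtain ⟨b, rfl⟩ := mem_deg_zero.1 h
    simp
  | succ n ih =>
    intro ω h
    refine deg_succ_induction (P := fun ω => parity ω = (-1 : ℂ) ^ (n + 1) • ω) ?_ ?_ ?_ ?_ h
    · simp
    · intro x y hx hy; rw [map_add, hx, hy, smul_add]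
    · intro c x hx; rw [map_smul, hx, smul_comm]
    · intro x hx b
      rw [map_mul, ih hx, parity_dgen]; simp [pow_succ]

theorem dgen_mul_mem_deg (a : A) {n : ℕ} : ∀ {ω : UnivForms A}, ω ∈ deg A n →
    dgen a * ω ∈ deg A (n + 1) := by
  induction n with
  | zero =>
    intro ω h
    obtain ⟨b, rfl⟩ := mem_deg_zero.1 h
    have h1 : dgen a * of b = of 1 * dgen (a * b) - of a * dgen b := by
      rw [dgen_mul, map_one, one_mul, add_sub_cancel_left]
    rw [h1]
    exact sub_mem (mul_dgen_mem_deg _ (mem_deg_zero.2 ⟨_, rfl⟩))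
      (mul_dgen_mem_deg _ (mem_deg_zero.2 ⟨_, rfl⟩))
  | succ n ih =>
    intro ω h
    refine deg_succ_induction (P := fun ω => dgen a * ω ∈ deg A (n + 1 + 1)) ?_ ?_ ?_ ?_ h
    · simp
    · intro x y hx hy; rw [mul_add]; exact add_mem hx hy
    · intro c x hx; rw [mul_smul_comm]; exact Submodule.smul_mem _ _ hx
    · intro x hx b
      rw [← mul_assoc]; exact mul_dgen_mem_deg _ (ih hx)

theorem delta_mem_deg {n : ℕ} : ∀ {ω : UnivForms A}, ω ∈ deg A n →
    delta ω ∈ deg A (n + 1) := by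
  induction n with
  | zero =>
    intro ω h
    obtain ⟨b, rfl⟩ := mem_deg_zero.1 h
    have := mul_dgen_mem_deg b (mem_deg_zero.2 ⟨(1 : A), rfl⟩)
    simpa using this
  | succ n ih =>
    intro ω h
    refine deg_succ_induction (P := fun ω => delta ω ∈ deg A (n + 1 + 1)) ?_ ?_ ?_ ?_ h
    · simp
    · intro x y hx hy; rw [map_add]; exact add_mem hx hy
    · intro c x hx; rw [map_smul]; exact Submodule.smul_mem _ _ hx
    · intro x hx b
      rw [delta_mul, delta_dgen, mul_zero, zero_add]
      exact mul_dgen_mem_deg _ (ih hx)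

end UnivForms

/-! ### The complex of a representation of `Ω(A)` -/

open UnivForms

variable {A : Type*} [Ring A] [Algebra ℂ A] {B : Type*} [Ring B] [Algebra ℂ B]

/-- `Jₙ`, the kernel of `ψ` on `Ωⁿ(A)`. -/
def kerDeg (ψ : UnivForms A →ₐ[ℂ] B) (n : ℕ) : Submodule ℂ (UnivForms A) :=
  deg A n ⊓ LinearMap.ker ψ.toLinearMap

/-- `Jₙ + δ Jₙ₋₁`, where `J₋₁ = 0`. -/
def junk (ψ : UnivForms A →ₐ[ℂ] B) : ℕ → Submodule ℂ (UnivForms A)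
  | 0 => kerDeg ψ 0
  | n + 1 => kerDeg ψ (n + 1) ⊔ (kerDeg ψ n).map delta

theorem junk_le_deg (ψ : UnivForms A →ₐ[ℂ] B) (n : ℕ) : junk ψ n ≤ deg A n := by
  cases n with
  | zero => exact inf_le_left
  | succ n =>
    refine sup_le inf_le_left ?_
    rintro _ ⟨x, hx, rfl⟩
    exact delta_mem_deg hx.1

/-- The space `Ωⁿ(A) / (Jₙ + δ Jₙ₋₁)`. -/
def Forms (ψ : UnivForms A →ₐ[ℂ] B) (n : ℕ) : Type _ :=
  deg A n ⧸ (junk ψ n).submoduleOf (deg A n)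

instance (ψ : UnivForms A →ₐ[ℂ] B) (n : ℕ) : AddCommGroup (Forms ψ n) :=
  inferInstanceAs (AddCommGroup (deg A n ⧸ (junk ψ n).submoduleOf (deg A n)))

instance (ψ : UnivForms A →ₐ[ℂ] B) (n : ℕ) : Module ℂ (Forms ψ n) :=
  inferInstanceAs (Module ℂ (deg A n ⧸ (junk ψ n).submoduleOf (deg A n)))

/-- The class of an element of `Ωⁿ(A)` in `Ωⁿ(A) / (Jₙ + δ Jₙ₋₁)`. -/
def Forms.mk (ψ : UnivForms A →ₐ[ℂ] B) (n : ℕ) : deg A n →ₗ[ℂ] Forms ψ n :=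
  ((junk ψ n).submoduleOf (deg A n)).mkQ

theorem of_mul_mem_kerDeg (ψ : UnivForms A →ₐ[ℂ] B) (a : A) {n : ℕ} {ω : UnivForms A}
    (h : ω ∈ kerDeg ψ n) : of a * ω ∈ kerDeg ψ n := by
  refine ⟨of_mul_mem_deg a h.1, ?_⟩
  have h2 : ψ ω = 0 := h.2
  change ψ (of a * ω) = 0
  rw [map_mul, h2, mul_zero]

theorem mul_of_mem_kerDeg (ψ : UnivForms A →ₐ[ℂ] B) (a : A) {n : ℕ} {ω : UnivForms A}
    (h : ω ∈ kerDeg ψ n) : ω * of a ∈ kerDeg ψ n := by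
  refine ⟨mul_of_mem_deg a h.1, ?_⟩
  have h2 : ψ ω = 0 := h.2
  change ψ (ω * of a) = 0
  rw [map_mul, h2, zero_mul]

theorem dgen_mul_mem_kerDeg (ψ : UnivForms A →ₐ[ℂ] B) (a : A) {n : ℕ} {ω : UnivForms A}
    (h : ω ∈ kerDeg ψ n) : dgen a * ω ∈ kerDeg ψ (n + 1) := by
  refine ⟨dgen_mul_mem_deg a h.1, ?_⟩
  have h2 : ψ ω = 0 := h.2
  change ψ (dgen a * ω) = 0
  rw [map_mul, h2, mul_zero]

theorem mul_dgen_mem_kerDeg (ψ : UnivForms A →ₐ[ℂ] B) (a : A) {n : ℕ} {ω : UnivForms A}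
    (h : ω ∈ kerDeg ψ n) : ω * dgen a ∈ kerDeg ψ (n + 1) := by
  refine ⟨mul_dgen_mem_deg a h.1, ?_⟩
  have h2 : ψ ω = 0 := h.2
  change ψ (ω * dgen a) = 0
  rw [map_mul, h2, zero_mul]

theorem of_mul_mem_junk (ψ : UnivForms A →ₐ[ℂ] B) (a : A) {n : ℕ} {ω : UnivForms A}
    (h : ω ∈ junk ψ n) : of a * ω ∈ junk ψ n := by
  cases n with
  | zero => exact of_mul_mem_kerDeg ψ a h
  | succ n =>
    obtain ⟨x, hx, _, ⟨z, hz, rfl⟩, rfl⟩ := Submodule.mem_sup.1 h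
    have e : of a * (x + delta z) = (of a * x - dgen a * z) + delta (of a * z) := by
      rw [delta_mul, parity_of, delta_of]; noncomm_ring
    rw [e]
    exact Submodule.add_mem_sup
      (sub_mem (of_mul_mem_kerDeg ψ a hx) (dgen_mul_mem_kerDeg ψ a hz))
      ⟨_, of_mul_mem_kerDeg ψ a hz, rfl⟩

theorem mul_of_mem_junk (ψ : UnivForms A →ₐ[ℂ] B) (a : A) {n : ℕ} {ω : UnivForms A}
    (h : ω ∈ junk ψ n) : ω * of a ∈ junk ψ n := by
  cases n with
  | zero => exact mul_of_mem_kerDeg ψ a h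
  | succ n =>
    obtain ⟨x, hx, _, ⟨z, hz, rfl⟩, rfl⟩ := Submodule.mem_sup.1 h
    have e : (x + delta z) * of a =
        (x * of a - (-1 : ℂ) ^ n • (z * dgen a)) + delta (z * of a) := by
      rw [delta_mul, delta_of, parity_eq hz.1, smul_mul_assoc]; noncomm_ring
    rw [e]
    exact Submodule.add_mem_sup
      (sub_mem (mul_of_mem_kerDeg ψ a hx)
        (Submodule.smul_mem _ _ (mul_dgen_mem_kerDeg ψ a hz)))
      ⟨_, mul_of_mem_kerDeg ψ a hz, rfl⟩

/-- Left multiplication by `a ∈ A` on `Ωⁿ(A)`. -/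
def leftMul (n : ℕ) (a : A) : deg A n →ₗ[ℂ] deg A n :=
  (LinearMap.mulLeft ℂ (of a)).restrict fun _ h => of_mul_mem_deg a h

/-- Right multiplication by `a ∈ A` on `Ωⁿ(A)`. -/
def rightMul (n : ℕ) (a : A) : deg A n →ₗ[ℂ] deg A n :=
  (LinearMap.mulRight ℂ (of a)).restrict fun _ h => mul_of_mem_deg a h

/-- Left multiplication by `a ∈ A` on `Ωⁿ(A) / (Jₙ + δ Jₙ₋₁)`. -/
def Forms.left (ψ : UnivForms A →ₐ[ℂ] B) (n : ℕ) (a : A) : Forms ψ n →ₗ[ℂ] Forms ψ n :=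
  Submodule.mapQ _ _ (leftMul n a) fun _ h => of_mul_mem_junk ψ a h

/-- Right multiplication by `a ∈ A` on `Ωⁿ(A) / (Jₙ + δ Jₙ₋₁)`. -/
def Forms.right (ψ : UnivForms A →ₐ[ℂ] B) (n : ℕ) (a : A) : Forms ψ n →ₗ[ℂ] Forms ψ n :=
  Submodule.mapQ _ _ (rightMul n a) fun _ h => mul_of_mem_junk ψ a h

theorem Forms.mk_surjective (ψ : UnivForms A →ₐ[ℂ] B) (n : ℕ) :
    Function.Surjective (Forms.mk ψ n) := Submodule.mkQ_surjective _

theorem Forms.left_mk (ψ : UnivForms A →ₐ[ℂ] B) (n : ℕ) (a : A) (ω : deg A n) :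
    Forms.left ψ n a (Forms.mk ψ n ω) = Forms.mk ψ n ⟨of a * ω, of_mul_mem_deg a ω.2⟩ := rfl

theorem Forms.right_mk (ψ : UnivForms A →ₐ[ℂ] B) (n : ℕ) (a : A) (ω : deg A n) :
    Forms.right ψ n a (Forms.mk ψ n ω) = Forms.mk ψ n ⟨ω * of a, mul_of_mem_deg a ω.2⟩ := rfl

/-- The left action of `A` on `Ωⁿ(A) / (Jₙ + δ Jₙ₋₁)`. -/
instance (ψ : UnivForms A →ₐ[ℂ] B) (n : ℕ) : Module A (Forms ψ n) where
  smul a x := Forms.left ψ n a x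
  one_smul x := by
    change Forms.left ψ n 1 x = x
    obtain ⟨ω, rfl⟩ := Forms.mk_surjective ψ n x
    rw [Forms.left_mk]; congr 1; ext; simp
  mul_smul a b x := by
    change Forms.left ψ n (a * b) x = Forms.left ψ n a (Forms.left ψ n b x)
    obtain ⟨ω, rfl⟩ := Forms.mk_surjective ψ n x
    simp only [Forms.left_mk]; congr 1; ext; simp [mul_assoc]
  smul_zero a := map_zero _
  smul_add a x y := map_add _ x y
  add_smul a b x := by
    change Forms.left ψ n (a + b) x = Forms.left ψ n a x + Forms.left ψ n b x
    obtain ⟨ω, rfl⟩ := Forms.mk_surjective ψ n x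
    simp only [Forms.left_mk, ← map_add]; congr 1; ext; simp [add_mul]
  zero_smul x := by
    change Forms.left ψ n 0 x = 0
    obtain ⟨ω, rfl⟩ := Forms.mk_surjective ψ n x
    rw [Forms.left_mk, ← map_zero (Forms.mk ψ n)]; congr 1; ext; simp

/-- The right action of `A` on `Ωⁿ(A) / (Jₙ + δ Jₙ₋₁)`. -/
instance (ψ : UnivForms A →ₐ[ℂ] B) (n : ℕ) : Module Aᵐᵒᵖ (Forms ψ n) where
  smul a x := Forms.right ψ n a.unop x
  one_smul x := by
    change Forms.right ψ n 1 x = x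
    obtain ⟨ω, rfl⟩ := Forms.mk_surjective ψ n x
    rw [Forms.right_mk]; congr 1; ext; simp
  mul_smul a b x := by
    change Forms.right ψ n (b.unop * a.unop) x =
      Forms.right ψ n a.unop (Forms.right ψ n b.unop x)
    obtain ⟨ω, rfl⟩ := Forms.mk_surjective ψ n x
    simp only [Forms.right_mk]; congr 1; ext; simp [mul_assoc]
  smul_zero a := map_zero _
  smul_add a x y := map_add _ x y
  add_smul a b x := by
    change Forms.right ψ n (a.unop + b.unop) x =
      Forms.right ψ n a.unop x + Forms.right ψ n b.unop x
    obtain ⟨ω, rfl⟩ := Forms.mk_surjective ψ n x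
    simp only [Forms.right_mk, ← map_add]; congr 1; ext; simp [mul_add]
  zero_smul x := by
    change Forms.right ψ n 0 x = 0
    obtain ⟨ω, rfl⟩ := Forms.mk_surjective ψ n x
    rw [Forms.right_mk, ← map_zero (Forms.mk ψ n)]; congr 1; ext; simp

end Universal

/-! ### The Hilbert space, the algebra and the Dirac operator -/

section Operators

/-- The Hilbert space `L₂(ℕ) ⊗ L₂(ℤ) = ℓ²(ℕ × ℤ)`, with orthonormal basis
`e_{ij} = lp.single 2 (i, j) 1`. -/
abbrev Hilb : Type := lp (fun _ : ℕ × ℤ => ℂ) 2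

theorem memℓp_weighted {f : ℕ × ℤ → ℕ × ℤ} (hf : Function.Injective f) {w : ℕ × ℤ → ℂ}
    (hw : ∃ C, ∀ k, ‖w k‖ ≤ C) (x : Hilb) : Memℓp (fun k => w k * x (f k)) 2 := by
  obtain ⟨C, hC⟩ := hw
  have h2 : (0 : ℝ) < (2 : ℝ≥0∞).toReal := by norm_num
  have hx := (lp.memℓp x).summable h2
  refine memℓp_gen ?_
  refine Summable.of_nonneg_of_le (fun k => by positivity) (fun k => ?_)
    ((hx.comp_injective hf).mul_left (C ^ (2 : ℝ≥0∞).toReal))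
  have h0 : 0 ≤ C := (norm_nonneg _).trans (hC k)
  rw [norm_mul, Real.mul_rpow (norm_nonneg _) (norm_nonneg _)]
  exact mul_le_mul_of_nonneg_right
    (Real.rpow_le_rpow (norm_nonneg _) (hC k) h2.le) (by positivity)

/-- The bounded operator `x ↦ (k ↦ w k * x (f k))`, for a bounded weight `w` and an injective
map `f`. -/
def weighted (f : ℕ × ℤ → ℕ × ℤ) (hf : Function.Injective f) (w : ℕ × ℤ → ℂ)
    (hw : ∃ C, ∀ k, ‖w k‖ ≤ C) : Hilb →L[ℂ] Hilb :=
  LinearMap.mkContinuousOfExistsBound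
    { toFun := fun x => ⟨fun k => w k * x (f k), memℓp_weighted hf hw x⟩
      map_add' := fun x y => by ext k; exact mul_add _ _ _
      map_smul' := fun c x => by ext k; simp [mul_left_comm] } (by
    obtain ⟨C, hC⟩ := hw
    have h0 : 0 ≤ C := (norm_nonneg _).trans (hC (0, 0))
    have h2 : (0 : ℝ) < (2 : ℝ≥0∞).toReal := by norm_num
    refine ⟨C, fun x => lp.norm_le_of_forall_sum_le h2 (by positivity) fun s => ?_⟩
    rw [Real.mul_rpow h0 (norm_nonneg _), lp.norm_rpow_eq_tsum h2]
    have hx := (lp.memℓp x).summable h2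
    calc ∑ k ∈ s, ‖w k * x (f k)‖ ^ (2 : ℝ≥0∞).toReal
        ≤ ∑ k ∈ s, C ^ (2 : ℝ≥0∞).toReal * ‖x (f k)‖ ^ (2 : ℝ≥0∞).toReal := by
          refine Finset.sum_le_sum fun k _ => ?_
          rw [norm_mul, Real.mul_rpow (norm_nonneg _) (norm_nonneg _)]
          exact mul_le_mul_of_nonneg_right
            (Real.rpow_le_rpow (norm_nonneg _) (hC k) h2.le) (by positivity)
      _ = C ^ (2 : ℝ≥0∞).toReal * ∑ k ∈ s, ‖x (f k)‖ ^ (2 : ℝ≥0∞).toReal := by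
          rw [Finset.mul_sum]
      _ ≤ _ := by
          refine mul_le_mul_of_nonneg_left ?_ (by positivity)
          calc ∑ k ∈ s, ‖x (f k)‖ ^ (2 : ℝ≥0∞).toReal
              ≤ ∑' k, ‖x (f k)‖ ^ (2 : ℝ≥0∞).toReal :=
                (hx.comp_injective hf).sum_le_tsum s fun k _ => by positivity
            _ ≤ ∑' k, ‖x k‖ ^ (2 : ℝ≥0∞).toReal :=
                tsum_comp_le_tsum_of_inj hx (fun k => by positivity) hf)

@[simp] theorem weighted_apply (f : ℕ × ℤ → ℕ × ℤ) (hf : Function.Injective f) (w : ℕ × ℤ → ℂ)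
    (hw : ∃ C, ∀ k, ‖w k‖ ≤ C) (x : Hilb) (k : ℕ × ℤ) :
    weighted f hf w hw x k = w k * x (f k) := rfl

theorem shiftN_injective : Function.Injective fun k : ℕ × ℤ => (k.1 + 1, k.2) := by
  rintro ⟨i, j⟩ ⟨i', j'⟩ h
  simpa using h

theorem shiftZ_injective : Function.Injective fun k : ℕ × ℤ => (k.1, k.2 + 1) := by
  rintro ⟨i, j⟩ ⟨i', j'⟩ h
  simpa using h

/-- `α = ℓ √(1 - q^{2N}) ⊗ I`, that is `α e_{ij} = √(1 - q^{2i}) e_{i-1,j}` for `i ≥ 1`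
and `α e_{0j} = 0`. -/
def alpha (q : ℝ) : Hilb →L[ℂ] Hilb :=
  weighted (fun k => (k.1 + 1, k.2)) shiftN_injective
    (fun k => (Real.sqrt (1 - q ^ (2 * (k.1 + 1))) : ℂ)) ⟨1, fun k => by
      rw [Complex.norm_real, Real.norm_of_nonneg (Real.sqrt_nonneg _)]
      refine Real.sqrt_le_one.2 ?_
      have : 0 ≤ q ^ (2 * (k.1 + 1)) := by rw [pow_mul]; positivity
      linarith⟩

/-- `β = q^N ⊗ ℓ`, that is `β e_{ij} = q^i e_{i,j-1}`. -/
def beta (q : ℝ) (hq : |q| < 1) : Hilb →L[ℂ] Hilb :=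
  weighted (fun k => (k.1, k.2 + 1)) shiftZ_injective
    (fun k => ((q ^ k.1 : ℝ) : ℂ)) ⟨1, fun k => by
      rw [Complex.norm_real, Real.norm_eq_abs, abs_pow]
      exact pow_le_one₀ (abs_nonneg q) hq.le⟩

/-- The `*`-algebra `𝒜_f` generated by `α` and `β`, as an algebra of operators. -/
def Af (q : ℝ) (hq : |q| < 1) : StarSubalgebra ℂ (Hilb →L[ℂ] Hilb) :=
  StarAlgebra.adjoin ℂ {alpha q, beta q hq}

/-- The generator `β` as an element of `𝒜_f`. -/
def betaAf (q : ℝ) (hq : |q| < 1) : Af q hq :=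
  ⟨beta q hq, StarAlgebra.subset_adjoin ℂ _ (by simp)⟩

/-- `ℐ_β`, the two-sided ideal of `𝒜_f` generated by `β` and `β*`. -/
def idealBeta (q : ℝ) (hq : |q| < 1) : TwoSidedIdeal (Af q hq) :=
  TwoSidedIdeal.span {betaAf q hq, star (betaAf q hq)}

/-- The eigenvalue of `I ⊗ S` on `e_{ij}`: `1` for `j ≥ 0` and `-1` for `j < 0`. -/
def sgn (j : ℤ) : ℝ := if 0 ≤ j then 1 else -1

/-- The operator `I ⊗ S`. -/
def signOp : Hilb →L[ℂ] Hilb :=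
  weighted id Function.injective_id (fun k => (sgn k.2 : ℂ)) ⟨1, fun k => by
    unfold sgn; split_ifs <;> simp⟩

/-- The eigenvalue of `N ⊗ S + I ⊗ N` on `e_{ij}`. -/
def diracEig (k : ℕ × ℤ) : ℝ := k.1 * sgn k.2 + k.2

/-- The self-adjoint operator `D = N ⊗ S + I ⊗ N`, that is `D e_{ij} = d_{ij} e_{ij}`, on its
natural domain `{x | ∑ |d_{ij} x_{ij}|² < ∞}`. -/
def dirac : Hilb →ₗ.[ℂ] Hilb where
  domain :=
    { carrier := {x | Memℓp (fun k => (diracEig k : ℂ) * x k) 2}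
      add_mem' := fun {x y} hx hy => by
        have := Memℓp.add hx hy
        simpa [mul_add, Pi.add_def] using this
      zero_mem' := by
        have : Memℓp (fun _ : ℕ × ℤ => (0 : ℂ)) 2 := zero_memℓp
        simpa using this
      smul_mem' := fun c x hx => by
        have := Memℓp.const_smul hx c
        simpa [mul_left_comm, Pi.smul_def] using this }
  toFun :=
    { toFun := fun x => ⟨fun k => (diracEig k : ℂ) * x.1 k, x.2⟩
      map_add' := fun x y => by ext k; exact mul_add _ _ _
      map_smul' := fun c x => by ext k; simp [mul_left_comm] }

/-- `T` is the bounded extension of the commutator `[D, a]`: the operator `a` preserves the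
domain of `D`, and `T x = D a x - a D x` for all `x` in the domain. -/
def IsCommutator (D : Hilb →ₗ.[ℂ] Hilb) (a T : Hilb →L[ℂ] Hilb) : Prop :=
  ∀ x : D.domain, ∃ h : a x ∈ D.domain, T x = D ⟨a x, h⟩ - a (D x)

theorem mem_dirac_domain {x : Hilb} :
    x ∈ dirac.domain ↔ Memℓp (fun k => (diracEig k : ℂ) * x k) 2 := Iff.rfl

theorem dirac_apply (x : dirac.domain) (k : ℕ × ℤ) :
    dirac x k = (diracEig k : ℂ) * x.1 k := rfl

/-- It is enough to compare coordinates. -/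
theorem isCommutator_iff (a T : Hilb →L[ℂ] Hilb) :
    IsCommutator dirac a T ↔ ∀ (x : dirac.domain) (k : ℕ × ℤ),
      (diracEig k : ℂ) * a x k = T x k + a (dirac x) k := by
  constructor
  · intro h x k
    obtain ⟨h1, h2⟩ := h x
    rw [h2, lp.coeFn_sub, Pi.sub_apply, dirac_apply]
    ring
  · intro h x
    have h1 : a x ∈ dirac.domain := by
      rw [mem_dirac_domain]
      have := lp.memℓp (T x + a (dirac x))
      rwa [show ((T x + a (dirac x) : Hilb) : ℕ × ℤ → ℂ) =
        fun k => (diracEig k : ℂ) * a x k from funext fun k => (h x k).symm] at this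
    refine ⟨h1, ?_⟩
    ext k
    rw [lp.coeFn_sub, Pi.sub_apply, dirac_apply, h x k]
    ring

theorem single_mem_domain (k : ℕ × ℤ) (c : ℂ) :
    (lp.single 2 k c : Hilb) ∈ dirac.domain := by
  rw [mem_dirac_domain]
  have := lp.memℓp (lp.single 2 k ((diracEig k : ℂ) * c) : Hilb)
  convert this using 1
  ext l
  by_cases h : l = k
  · subst h; simp
  · simp [lp.single_apply, h]

theorem dirac_single (k : ℕ × ℤ) (c : ℂ) :
    dirac ⟨lp.single 2 k c, single_mem_domain k c⟩ = (diracEig k : ℂ) • lp.single 2 k c := by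
  ext l
  rw [dirac_apply, lp.coeFn_smul, Pi.smul_apply, smul_eq_mul]
  by_cases h : l = k
  · subst h; simp
  · simp [lp.single_apply, h]

theorem ext_single {S T : Hilb →L[ℂ] Hilb}
    (h : ∀ k, S (lp.single 2 k 1) = T (lp.single 2 k 1)) : S = T := by
  ext1 x
  have hx := lp.hasSum_single (p := 2) (by norm_num) x
  have e : ∀ k, S (lp.single 2 k (x k)) = T (lp.single 2 k (x k)) := fun k => by
    have : (lp.single 2 k (x k) : Hilb) = x k • lp.single 2 k 1 := by
      rw [← lp.single_smul]; simp
    rw [this, map_smul, map_smul, h]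
  have h1 := hx.mapL S
  have h2 := hx.mapL T
  simp only [e] at h1
  exact h1.unique h2

theorem IsCommutator.unique {a S T : Hilb →L[ℂ] Hilb} (hS : IsCommutator dirac a S)
    (hT : IsCommutator dirac a T) : S = T := by
  refine ext_single fun k => ?_
  obtain ⟨_, h1⟩ := hS ⟨_, single_mem_domain k 1⟩
  obtain ⟨_, h2⟩ := hT ⟨_, single_mem_domain k 1⟩
  exact h1.trans h2.symm

theorem IsCommutator.add {a b S T : Hilb →L[ℂ] Hilb} (hS : IsCommutator dirac a S)
    (hT : IsCommutator dirac b T) : IsCommutator dirac (a + b) (S + T) := by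
  rw [isCommutator_iff] at *
  intro x k
  simp only [add_apply, lp.coeFn_add, Pi.add_apply, mul_add, hS x k, hT x k]
  ring

theorem IsCommutator.smul {a S : Hilb →L[ℂ] Hilb} (c : ℂ) (hS : IsCommutator dirac a S) :
    IsCommutator dirac (c • a) (c • S) := by
  rw [isCommutator_iff] at *
  intro x k
  simp only [smul_apply, lp.coeFn_smul, Pi.smul_apply, smul_eq_mul,
    mul_left_comm _ c, hS x k]
  ring

theorem IsCommutator.mul {a b S T : Hilb →L[ℂ] Hilb} (hS : IsCommutator dirac a S)
    (hT : IsCommutator dirac b T) : IsCommutator dirac (a * b) (a * T + S * b) := by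
  intro x
  obtain ⟨h1, h2⟩ := hT x
  obtain ⟨h3, h4⟩ := hS ⟨b x, h1⟩
  refine ⟨h3, ?_⟩
  simp only [add_apply, mul_apply_eq_comp, h2, map_sub]
  simp only at h4
  rw [h4]
  change _ = dirac ⟨a (b x), h3⟩ - _
  abel

theorem isCommutator_one : IsCommutator dirac 1 0 := by
  rw [isCommutator_iff]
  intro x k
  simp [dirac_apply]

theorem dirac_symm (x y : dirac.domain) : inner ℂ (dirac x) y.1 = inner ℂ x.1 (dirac y) := by
  rw [lp.inner_eq_tsum, lp.inner_eq_tsum]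
  refine tsum_congr fun k => ?_
  simp only [dirac_apply, RCLike.inner_apply, map_mul, Complex.conj_ofReal]
  ring

theorem IsCommutator.star {a S : Hilb →L[ℂ] Hilb} (hS : IsCommutator dirac a S) :
    IsCommutator dirac (star a) (-star S) := by
  rw [isCommutator_iff]
  intro x k
  have coord : ∀ y : Hilb, y k = inner ℂ (lp.single 2 k 1 : Hilb) y := fun y => by
    rw [lp.inner_single_left]; simp
  obtain ⟨h1, h2⟩ := hS ⟨_, single_mem_domain k 1⟩
  rw [dirac_single, map_smul] at h2
  have h3 := dirac_symm ⟨_, h1⟩ x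
  rw [show dirac ⟨a (lp.single 2 k 1), h1⟩ =
    S (lp.single 2 k 1) + (diracEig k : ℂ) • a (lp.single 2 k 1) by
      rw [h2]; abel] at h3
  rw [inner_add_left, inner_smul_left, Complex.conj_ofReal] at h3
  rw [coord (Star.star a x), coord ((-Star.star S) x), coord (Star.star a (dirac x))]
  simp only [neg_apply, inner_neg_right,
    ContinuousLinearMap.star_eq_adjoint, ContinuousLinearMap.adjoint_inner_right]
  linear_combination h3

theorem isCommutator_weighted (f : ℕ × ℤ → ℕ × ℤ) (hf : Function.Injective f)
    (w : ℕ × ℤ → ℂ) (hw : ∃ C, ∀ k, ‖w k‖ ≤ C)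
    (hd : ∃ C, ∀ k, ‖((diracEig k - diracEig (f k) : ℝ) : ℂ) * w k‖ ≤ C) :
    IsCommutator dirac (weighted f hf w hw) (weighted f hf _ hd) := by
  rw [isCommutator_iff]
  intro x k
  simp only [weighted_apply, dirac_apply]
  push_cast
  ring

theorem exists_commutator_alpha (q : ℝ) : ∃ T, IsCommutator dirac (alpha q) T := by
  refine ⟨_, isCommutator_weighted _ _ _ _ ⟨1, fun k => ?_⟩⟩
  have h : diracEig k - diracEig (k.1 + 1, k.2) = -sgn k.2 := by
    simp only [diracEig]; push_cast; ring
  have h1 : ‖((-sgn k.2 : ℝ) : ℂ)‖ = 1 := by unfold sgn; split_ifs <;> simp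
  have h2 : 0 ≤ q ^ (2 * (k.1 + 1)) := by rw [pow_mul]; positivity
  rw [h, norm_mul, h1, one_mul, Complex.norm_real, Real.norm_of_nonneg (Real.sqrt_nonneg _)]
  refine Real.sqrt_le_one.2 ?_
  linarith

theorem exists_commutator_beta (q : ℝ) (hq : |q| < 1) :
    ∃ T, IsCommutator dirac (beta q hq) T := by
  obtain ⟨C, hC⟩ := (tendsto_self_mul_const_pow_of_abs_lt_one
    (r := |q|) (by rwa [abs_abs])).bddAbove_range
  refine ⟨_, isCommutator_weighted _ _ _ _ ⟨2 * C + 1, fun k => ?_⟩⟩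
  have hC' : (k.1 : ℝ) * |q| ^ k.1 ≤ C := hC ⟨k.1, rfl⟩
  have h : |diracEig k - diracEig (k.1, k.2 + 1)| ≤ 2 * k.1 + 1 := by
    have hk : (0 : ℝ) ≤ k.1 := Nat.cast_nonneg _
    simp only [diracEig, sgn]
    push_cast
    split_ifs <;> rw [abs_le] <;> constructor <;> linarith
  have hp : |q| ^ k.1 ≤ 1 := pow_le_one₀ (abs_nonneg q) hq.le
  rw [norm_mul, Complex.norm_real, Complex.norm_real, Real.norm_eq_abs, Real.norm_eq_abs,
    abs_pow]
  calc _ ≤ (2 * k.1 + 1) * |q| ^ k.1 := mul_le_mul_of_nonneg_right h (by positivity)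
    _ ≤ 2 * C + 1 := by linarith

/-- `[D, a]` is bounded for every `a ∈ 𝒜_f`. -/
theorem exists_commutator (q : ℝ) (hq : |q| < 1) (a : Af q hq) :
    ∃ T, IsCommutator dirac a T := by
  obtain ⟨a, ha⟩ := a
  induction ha using StarAlgebra.adjoin_induction with
  | mem x hx =>
    rcases hx with rfl | rfl
    · exact exists_commutator_alpha q
    · exact exists_commutator_beta q hq
  | algebraMap c =>
    refine ⟨c • 0, ?_⟩
    simp only [Algebra.algebraMap_eq_smul_one]
    exact isCommutator_one.smul c
  | add x y _ _ hx hy =>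
    obtain ⟨S, hS⟩ := hx
    obtain ⟨T, hT⟩ := hy
    exact ⟨_, hS.add hT⟩
  | mul x y _ _ hx hy =>
    obtain ⟨S, hS⟩ := hx
    obtain ⟨T, hT⟩ := hy
    exact ⟨_, hS.mul hT⟩
  | star x _ hx =>
    obtain ⟨S, hS⟩ := hx
    exact ⟨_, hS.star⟩

/-- The bounded operator `[D, a]`, for `a ∈ 𝒜_f`. -/
def comm (q : ℝ) (hq : |q| < 1) (a : Af q hq) : Hilb →L[ℂ] Hilb :=
  (exists_commutator q hq a).choose

theorem comm_spec (q : ℝ) (hq : |q| < 1) (a : Af q hq) :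
    IsCommutator dirac a (comm q hq a) := (exists_commutator q hq a).choose_spec

/-- The linear map `a ↦ [D, a]`. -/
def commLin (q : ℝ) (hq : |q| < 1) : Af q hq →ₗ[ℂ] Hilb →L[ℂ] Hilb where
  toFun := comm q hq
  map_add' a b := (comm_spec q hq (a + b)).unique ((comm_spec q hq a).add (comm_spec q hq b))
  map_smul' c a := (comm_spec q hq (c • a)).unique ((comm_spec q hq a).smul c)

/-- The representation `π : Ω(𝒜_f) → 𝓛(𝓗)`,
`a₀ (δ a₁) ⋯ (δ aₙ) ↦ a₀ [D, a₁] ⋯ [D, aₙ]`. -/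
def piRep (q : ℝ) (hq : |q| < 1) : UnivForms (Af q hq) →ₐ[ℂ] Hilb →L[ℂ] Hilb :=
  UnivForms.lift (Af q hq).subtype.toAlgHom (commLin q hq) fun a b =>
    (comm_spec q hq (a * b)).unique ((comm_spec q hq a).mul (comm_spec q hq b))

/-- The ideal of compact operators. -/
def compactIdeal : Ideal (Hilb →L[ℂ] Hilb) where
  carrier := {T | IsCompactOperator T}
  add_mem' hS hT := hS.add hT
  zero_mem' := isCompactOperator_zero
  smul_mem' S _ hT := hT.clm_comp S

instance : compactIdeal.IsTwoSided where
  mul_mem_of_left {T} S hT := IsCompactOperator.comp_clm (f := T) hT S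

/-- The Calkin algebra `𝓠(𝓗)`. -/
abbrev Calkin : Type := (Hilb →L[ℂ] Hilb) ⧸ compactIdeal

/-- The projection `θ : 𝓛(𝓗) → 𝓠(𝓗)`. -/
def theta : (Hilb →L[ℂ] Hilb) →ₐ[ℂ] Calkin := Ideal.Quotient.mkₐ ℂ compactIdeal

/-- The representation `ψ = θ ∘ π : Ω(𝒜_f) → 𝓠(𝓗)`. -/
def psi (q : ℝ) (hq : |q| < 1) : UnivForms (Af q hq) →ₐ[ℂ] Calkin := theta.comp (piRep q hq)

/-- `Ω_dⁿ(𝒜_f) = Ωⁿ(𝒜_f) / (Jₙ + δ Jₙ₋₁)`, where `Jₙ` is the kernel of `ψ` on `Ωⁿ(𝒜_f)`. -/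
abbrev OmegaD (q : ℝ) (hq : |q| < 1) (n : ℕ) : Type := Forms (psi q hq) n

end Operators

end ConnesDeRham

end

open ConnesDeRham

namespace ConnesDeRham

open Filter Topology

/-! ### Compactness of weighted operators -/

/-! Write `F` for the image of `I ⊗ S` in the Calkin algebra. Modulo compact operators, `F` is
central with respect to `𝒜_f`, `F² = 1`, and the commutators with `D` of `α`, `α*`, `β`, `β*` are
`-Fα`, `Fα*`, `-β`, `β*`: the corrections live on a single row of ℤ and decay there like `q^i` or `i
q^i`. By the Leibniz rule, `ψ` maps one-forms into `F𝒜_f + ℐ_β`. All of this is attained, because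
`αα* - q²α*α = 1 - q²` turns a combination of `α δα*` and `α* δα` into a form `ω` with `ψ(ω) = F`
(`psi_signForm`).

The pair `(b, c)` is determined by `θ((I ⊗ S)b + c)` (`eq_zero_of_isCompactOperator`). Matrix
coefficients of elements of `𝒜_f` are invariant under translation in ℤ, while those of a compact
operator vanish at infinity; the limits `j → ∞` and `j → -∞` give `b + c = 0` and `-b + c = 0`. In
particular `θ` is injective on `𝒜_f`, so `J₀ = 0` and `Ω_d¹` is the image of `ψ` on one-forms, which
is (i).

For (ii) it suffices that `ψ(Ω²)` lies in `ψ(δJ₁)`, a sub-bimodule; multiplication by `δa` on the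
right then gives the higher degrees. By `F² = 1`, products of two symbols lie in `𝒜_f + Fℐ_β`. The
form `δα α - α δα` is in `J₁` and its differential has image `-2α²`; the relation for `α` lowers
`α²` to `α` and then to `1`, so all of `θ(𝒜_f)` is reached (`one_mem_boundary`). Finally `aω - ωa`
is in `J₁`, and its differential has image `2F[D, a]` up to `θ(𝒜_f)`; taking `a = β, β*` gives
`Fℐ_β`. -/

theorem norm_weighted_apply_le {f : ℕ × ℤ → ℕ × ℤ} (hf : Function.Injective f) {w : ℕ × ℤ → ℂ}
    (hw : ∃ C, ∀ k, ‖w k‖ ≤ C) {C : ℝ} (hC : ∀ k, ‖w k‖ ≤ C) (x : Hilb) :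
    ‖weighted f hf w hw x‖ ≤ C * ‖x‖ := by
  have h0 : 0 ≤ C := (norm_nonneg _).trans (hC (0, 0))
  have h2 : (0 : ℝ) < (2 : ℝ≥0∞).toReal := by norm_num
  refine lp.norm_le_of_forall_sum_le h2 (by positivity) fun s => ?_
  rw [Real.mul_rpow h0 (norm_nonneg _), lp.norm_rpow_eq_tsum h2]
  have hx := (lp.memℓp x).summable h2
  calc ∑ k ∈ s, ‖w k * x (f k)‖ ^ (2 : ℝ≥0∞).toReal
      ≤ ∑ k ∈ s, C ^ (2 : ℝ≥0∞).toReal * ‖x (f k)‖ ^ (2 : ℝ≥0∞).toReal := by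
        refine Finset.sum_le_sum fun k _ => ?_
        rw [norm_mul, Real.mul_rpow (norm_nonneg _) (norm_nonneg _)]
        exact mul_le_mul_of_nonneg_right
          (Real.rpow_le_rpow (norm_nonneg _) (hC k) h2.le) (by positivity)
    _ = C ^ (2 : ℝ≥0∞).toReal * ∑ k ∈ s, ‖x (f k)‖ ^ (2 : ℝ≥0∞).toReal := by
        rw [Finset.mul_sum]
    _ ≤ _ := by
        refine mul_le_mul_of_nonneg_left ?_ (by positivity)
        exact ((hx.comp_injective hf).sum_le_tsum s fun k _ =>
          Real.rpow_nonneg (norm_nonneg _) _).trans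
          (tsum_comp_le_tsum_of_inj hx (fun k => Real.rpow_nonneg (norm_nonneg _) _) hf)

/-- The operator is a norm limit of finite-rank ones: keeping only the finitely many coordinates
with `‖w k‖ ≥ ε / 2` leaves a remainder that is again a weighted operator, of norm at most `ε / 2`.
-/
theorem isCompactOperator_weighted {f : ℕ × ℤ → ℕ × ℤ} (hf : Function.Injective f)
    {w : ℕ × ℤ → ℂ} (hw : ∃ C, ∀ k, ‖w k‖ ≤ C) (h : Tendsto w cofinite (𝓝 0)) :
    IsCompactOperator (weighted f hf w hw) := by
  classical
  refine isClosed_setOfPred_isCompactOperator.closure_subset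
    (Metric.mem_closure_iff.2 fun ε hε => ?_)
  have hfin : {k | ε / 2 ≤ ‖w k‖}.Finite := by
    have := (Metric.tendsto_nhds.1 h (ε / 2) (by positivity))
    simpa [Filter.eventually_cofinite] using this
  let s := hfin.toFinset
  let F : Hilb →L[ℂ] Hilb := ∑ k ∈ s, (w k • lp.evalCLM ℂ (fun _ : ℕ × ℤ => ℂ) 2 (f k)).smulRight
    (lp.single 2 k 1 : Hilb)
  have hF : IsCompactOperator F := by
    refine Submodule.sum_mem (compactOperator (RingHom.id ℂ) Hilb Hilb) fun k _ => ?_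
    exact (isCompactOperator_of_locallyCompactSpace_dom
      (w k • lp.evalCLM ℂ (fun _ : ℕ × ℤ => ℂ) 2 (f k))).clm_comp
        ((ContinuousLinearMap.id ℂ ℂ).smulRight (lp.single 2 k 1 : Hilb))
  refine ⟨F, hF, ?_⟩
  have hC : ∀ k, ‖(if k ∈ s then 0 else w k)‖ ≤ ε / 2 := fun k => by
    split_ifs with hk
    · rw [norm_zero]; positivity
    · have : ¬ ε / 2 ≤ ‖w k‖ := fun hh => hk (hfin.mem_toFinset.2 hh)
      exact (not_le.1 this).le
  have hsub : weighted f hf w hw - F = weighted f hf _ ⟨ε / 2, hC⟩ := by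
    ext x k
    have hFk : F x k = ∑ l ∈ s, if k = l then w l * x (f l) else 0 := by
      simp only [F, sum_apply]
      rw [lp.coeFn_sum, Finset.sum_apply]
      refine Finset.sum_congr rfl fun l _ => ?_
      by_cases hkl : k = l
      · subst hkl; simp [lp.evalCLM]
      · simp [lp.single_apply, hkl]
    rw [sub_apply, lp.coeFn_sub, Pi.sub_apply, hFk, Finset.sum_ite_eq]
    simp only [weighted_apply]
    split_ifs <;> simp
  rw [dist_eq_norm, hsub]
  refine lt_of_le_of_lt (ContinuousLinearMap.opNorm_le_bound _ (by positivity)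
    (norm_weighted_apply_le hf _ hC)) (by linarith)

theorem tendsto_cofinite_of_row {w : ℕ × ℤ → ℂ} {j₀ : ℤ} (h0 : ∀ i j, j ≠ j₀ → w (i, j) = 0)
    (h : Tendsto (fun i => w (i, j₀)) atTop (𝓝 0)) : Tendsto w cofinite (𝓝 0) := by
  rw [Metric.tendsto_nhds]
  intro ε hε
  have h1 := Metric.tendsto_nhds.1 h ε hε
  rw [← Nat.cofinite_eq_atTop, Filter.eventually_cofinite] at h1
  rw [Filter.eventually_cofinite]
  refine (h1.image fun i => (i, j₀)).subset ?_
  rintro ⟨i, j⟩ hij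
  have hj : j = j₀ := by
    by_contra hj
    exact hij (by rw [h0 i j hj, dist_self]; exact hε)
  subst hj
  exact ⟨i, hij, rfl⟩

/-- Along a subsequence the images of the basis vectors converge in norm to some `y`, and the
coordinates of `y` at the indices `k' n` tend to zero because these leave every finite set. -/
theorem tendsto_coord_of_isCompactOperator {T : Hilb →L[ℂ] Hilb} (hT : IsCompactOperator T)
    (k k' : ℕ → ℕ × ℤ) (hk' : Function.Injective k') :
    Tendsto (fun n => T (lp.single 2 (k n) 1) (k' n)) atTop (𝓝 0) := by
  refine tendsto_of_subseq_tendsto fun ns hns => ?_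
  obtain ⟨K, hK, hTK⟩ := hT.image_closedBall_subset_compact (f := (T : Hilb →ₗ[ℂ] Hilb)) 1
  have hmem : ∀ n, T (lp.single 2 (k (ns n)) 1) ∈ K := fun n => hTK
    ⟨_, by simp [lp.norm_single], rfl⟩
  obtain ⟨y, -, ms, hms, hy⟩ := hK.tendsto_subseq hmem
  refine ⟨ms, ?_⟩
  have hy0 : Tendsto (fun l => y l) cofinite (𝓝 0) := by
    have h2 : (0 : ℝ) < (2 : ℝ≥0∞).toReal := by norm_num
    have h3 := ((lp.memℓp y).summable h2).tendsto_cofinite_zero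
    rw [tendsto_zero_iff_norm_tendsto_zero]
    -- Summability concerns `‖y l‖²`; the power `1 / 2` recovers `‖y l‖`.
    have h4 := h3.rpow_const (p := 1 / 2) (Or.inr (by norm_num))
    refine (h4.congr fun l => ?_).trans (by norm_num)
    rw [← Real.rpow_mul (norm_nonneg _)]; norm_num
  have h1 : Tendsto (fun n => y (k' (ns (ms n)))) atTop (𝓝 0) :=
    hy0.comp ((Nat.cofinite_eq_atTop ▸ hk'.tendsto_cofinite).comp (hns.comp hms.tendsto_atTop))
  have h2 : Tendsto (fun n => (T (lp.single 2 (k (ns (ms n))) 1) - y) (k' (ns (ms n)))) atTop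
      (𝓝 0) := by
    refine squeeze_zero_norm (fun n => lp.norm_apply_le_norm (by norm_num) _ _) ?_
    exact tendsto_iff_norm_sub_tendsto_zero.1 hy
  have h3 := h2.add h1
  rw [add_zero] at h3
  refine h3.congr fun n => ?_
  rw [lp.coeFn_sub, Pi.sub_apply, sub_add_cancel]

/-! ### The adjoint of a weighted shift -/

theorem shiftZ_neg_injective : Function.Injective fun k : ℕ × ℤ => (k.1, k.2 - 1) := by
  rintro ⟨i, j⟩ ⟨i', j'⟩ h
  simpa using h

theorem star_apply_coord (T : Hilb →L[ℂ] Hilb) (x : Hilb) (k : ℕ × ℤ) :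
    star T x k = inner ℂ (T (lp.single 2 k 1)) x := by
  have coord : ∀ y : Hilb, y k = inner ℂ (lp.single 2 k 1 : Hilb) y := fun y => by
    rw [lp.inner_single_left]; simp
  rw [coord, ContinuousLinearMap.star_eq_adjoint, ContinuousLinearMap.adjoint_inner_right]

theorem star_weighted_shiftZ {w : ℕ × ℤ → ℂ} (hw : ∃ C, ∀ k, ‖w k‖ ≤ C)
    (hw' : ∃ C, ∀ k : ℕ × ℤ, ‖starRingEnd ℂ (w (k.1, k.2 - 1))‖ ≤ C) :
    star (weighted _ shiftZ_injective w hw) =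
      weighted _ shiftZ_neg_injective (fun k => starRingEnd ℂ (w (k.1, k.2 - 1))) hw' := by
  ext x k
  have h : weighted _ shiftZ_injective w hw (lp.single 2 k 1) =
      lp.single 2 (k.1, k.2 - 1) (w (k.1, k.2 - 1)) := by
    ext l
    rw [weighted_apply]
    by_cases hl : l = (k.1, k.2 - 1)
    · subst hl; simp
    · have : (l.1, l.2 + 1) ≠ k := fun hk => hl (by rw [← hk]; simp)
      simp [lp.single_apply, hl, this]
  rw [star_apply_coord, h, lp.inner_single_left]
  simp [mul_comm]

/-! ### Translation invariance -/

/-- The bilateral shift in the second coordinate. -/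
noncomputable def shiftOp : Hilb →L[ℂ] Hilb :=
  weighted _ shiftZ_injective (fun _ => 1) ⟨1, fun _ => by simp⟩

theorem star_shiftOp : star shiftOp =
    weighted _ shiftZ_neg_injective (fun _ => 1) ⟨1, fun _ => by simp⟩ := by
  refine (star_weighted_shiftZ _ ⟨1, fun _ => by simp⟩).trans ?_
  simp

theorem shiftOp_single (i : ℕ) (j : ℤ) :
    shiftOp (lp.single 2 (i, j + 1) 1) = lp.single 2 (i, j) 1 := by
  ext l
  rw [shiftOp, weighted_apply]
  by_cases hl : l = (i, j)
  · subst hl; simp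
  · have : (l.1, l.2 + 1) ≠ (i, j + 1) := fun hk => hl (by
      rw [Prod.mk.injEq] at hk
      exact Prod.ext hk.1 (by simpa using hk.2))
    simp [lp.single_apply, hl, this]

variable (q : ℝ) (hq : |q| < 1)

/-- The generator `α` as an element of `𝒜_f`. -/
noncomputable def alphaAf : Af q hq := ⟨alpha q, StarAlgebra.subset_adjoin ℂ _ (by simp)⟩

variable {q hq}

-- The adjoints of the generators are separate cases, so that `P` need not be stable under `*`.
@[elab_as_elim]
theorem Af_induction {P : Af q hq → Prop} (hα : P (alphaAf q hq)) (hβ : P (betaAf q hq))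
    (hα' : P (star (alphaAf q hq))) (hβ' : P (star (betaAf q hq)))
    (halg : ∀ c : ℂ, P (c • 1)) (hadd : ∀ a b, P a → P b → P (a + b))
    (hmul : ∀ a b, P a → P b → P (a * b)) (a : Af q hq) : P a := by
  obtain ⟨a, ha⟩ := a
  change a ∈ Algebra.adjoin ℂ ({alpha q, beta q hq} ∪ star {alpha q, beta q hq}) at ha
  have key : ∃ h : a ∈ Af q hq, P ⟨a, h⟩ := by
    induction ha using Algebra.adjoin_induction with
    | mem x hx =>
      rcases hx with (rfl | rfl) | hx
      · exact ⟨_, hα⟩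
      · exact ⟨_, hβ⟩
      · rcases hx with hx | hx
        · obtain rfl : x = star (alpha q) := by rw [← hx, star_star]
          exact ⟨_, hα'⟩
        · obtain rfl : x = star (beta q hq) := by
            rw [← (show star x = beta q hq from hx), star_star]
          exact ⟨_, hβ'⟩
    | algebraMap c => exact ⟨_, halg c⟩
    | add x y _ _ hx hy =>
      obtain ⟨_, hx⟩ := hx
      obtain ⟨_, hy⟩ := hy
      exact ⟨_, hadd _ _ hx hy⟩
    | mul x y _ _ hx hy =>
      obtain ⟨_, hx⟩ := hx
      obtain ⟨_, hy⟩ := hy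
      exact ⟨_, hmul _ _ hx hy⟩
  exact key.2

theorem commute_shiftOp (a : Af q hq) : Commute (a : Hilb →L[ℂ] Hilb) shiftOp := by
  induction a using Af_induction with
  | hα => ext x k; simp [alphaAf, alpha, shiftOp]
  | hβ => ext x k; simp [betaAf, beta, shiftOp]
  | hα' =>
    -- Commuting with the inverse shift is checked on `α` itself, whose coordinates are explicit;
    -- taking adjoints gives the claim for `α*`.
    have : Commute (alpha q) (star shiftOp) := by
      rw [star_shiftOp]; ext x k; simp [alpha]
    simpa [alphaAf] using this.star_star
  | hβ' =>
    have : Commute (beta q hq) (star shiftOp) := by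
      rw [star_shiftOp]; ext x k; simp [beta]
    simpa [betaAf] using this.star_star
  | halg c => exact (Commute.one_left _).smul_left c
  | hadd a b ha hb => exact ha.add_left hb
  | hmul a b ha hb => exact ha.mul_left hb

theorem coord_translate (a : Af q hq) (i i' : ℕ) (j j' n : ℤ) :
    (a : Hilb →L[ℂ] Hilb) (lp.single 2 (i, j + n) 1) (i', j' + n) =
      (a : Hilb →L[ℂ] Hilb) (lp.single 2 (i, j) 1) (i', j') := by
  have step : ∀ j j' : ℤ, (a : Hilb →L[ℂ] Hilb) (lp.single 2 (i, j + 1) 1) (i', j' + 1) =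
      (a : Hilb →L[ℂ] Hilb) (lp.single 2 (i, j) 1) (i', j') := fun j j' => by
    have h := congrArg (fun T : Hilb →L[ℂ] Hilb => T (lp.single 2 (i, j + 1) 1) (i', j'))
      (commute_shiftOp a).eq
    simp only [mul_apply_eq_comp, shiftOp_single] at h
    rw [h]
    simp [shiftOp]
  induction n using Int.induction_on with
  | zero => simp
  | succ n ih => rw [← ih, ← add_assoc, ← add_assoc, step]
  | pred n ih =>
    rw [← ih, ← step]
    simp only [add_assoc, sub_add_cancel]

theorem eq_zero_of_coord {a : Af q hq} (h : ∀ i j i' j',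
    (a : Hilb →L[ℂ] Hilb) (lp.single 2 (i, j) 1) (i', j') = 0) : a = 0 := by
  refine Subtype.ext (ext_single fun k => ?_)
  ext l
  simpa using h k.1 k.2 l.1 l.2

@[simp] theorem signOp_apply (x : Hilb) (k : ℕ × ℤ) : signOp x k = (sgn k.2 : ℂ) * x k := rfl

/-- Translating both indices of a matrix coefficient by `n` changes neither the coefficient of `b`
nor that of `c`, and `I ⊗ S` is eventually `1` or `-1`. The coefficients of `b + c` and `-b + c` are
therefore constant sequences with limit zero. -/
theorem eq_zero_of_isCompactOperator {b c : Af q hq}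
    (h : IsCompactOperator (signOp * b + c : Hilb →L[ℂ] Hilb)) : b = 0 ∧ c = 0 := by
  have hc : ∀ i j i' j', (b : Hilb →L[ℂ] Hilb) (lp.single 2 (i, j) 1) (i', j') +
      (c : Hilb →L[ℂ] Hilb) (lp.single 2 (i, j) 1) (i', j') = 0 := fun i j i' j' => by
    have h1 := tendsto_coord_of_isCompactOperator h (fun n => (i, j + n)) (fun n => (i', j' + n))
      (fun m n hmn => by simpa using hmn)
    refine tendsto_nhds_unique (tendsto_const_nhds.congr' ?_) h1
    filter_upwards [eventually_ge_atTop j'.natAbs] with n hn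
    have : 0 ≤ j' + n := by omega
    simp [sgn, this, coord_translate, mul_apply_eq_comp]
  have hd : ∀ i j i' j', -(b : Hilb →L[ℂ] Hilb) (lp.single 2 (i, j) 1) (i', j') +
      (c : Hilb →L[ℂ] Hilb) (lp.single 2 (i, j) 1) (i', j') = 0 := fun i j i' j' => by
    have h1 := tendsto_coord_of_isCompactOperator h (fun n => (i, j + -(n : ℤ)))
      (fun n => (i', j' + -(n : ℤ))) (fun m n hmn => by simpa using hmn)
    refine tendsto_nhds_unique (tendsto_const_nhds.congr' ?_) h1
    -- The extra `1` makes `j' - n` strictly negative, since `sgn 0 = 1`.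
    filter_upwards [eventually_ge_atTop (j'.natAbs + 1)] with n hn
    have : ¬ 0 ≤ j' + -(n : ℤ) := by omega
    simp only [add_apply, mul_apply_eq_comp, lp.coeFn_add, Pi.add_apply, signOp_apply,
      coord_translate, sgn, this, if_false]
    simp
  constructor
  · refine eq_zero_of_coord fun i j i' j' => ?_
    linear_combination (hc i j i' j' - hd i j i' j') / 2
  · refine eq_zero_of_coord fun i j i' j' => ?_
    linear_combination (hc i j i' j' + hd i j i' j') / 2

/-! ### The generators modulo compact operators -/

theorem theta_eq_iff {S T : Hilb →L[ℂ] Hilb} :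
    theta S = theta T ↔ IsCompactOperator (S - T : Hilb →L[ℂ] Hilb) :=
  Ideal.Quotient.eq (I := compactIdeal)

/-- The index map `i ↦ i - 1` is not injective on ℕ, so `α*` is described by coordinates in two
cases and not as a `weighted` operator. -/
theorem star_alpha_apply_zero (x : Hilb) (j : ℤ) : star (alpha q) x (0, j) = 0 := by
  have h : alpha q (lp.single 2 (0, j) 1) = 0 := by
    ext l
    simp [alpha, lp.single_apply]
  rw [star_apply_coord, h, inner_zero_left]

theorem star_alpha_apply_succ (x : Hilb) (i : ℕ) (j : ℤ) :
    star (alpha q) x (i + 1, j) = (Real.sqrt (1 - q ^ (2 * (i + 1))) : ℂ) * x (i, j) := by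
  have h : alpha q (lp.single 2 (i + 1, j) 1) =
      lp.single 2 (i, j) (Real.sqrt (1 - q ^ (2 * (i + 1))) : ℂ) := by
    ext l
    by_cases hl : l = (i, j)
    · subst hl; simp [alpha]
    · have : (l.1 + 1, l.2) ≠ (i + 1, j) := fun hk => hl (by
        rw [Prod.mk.injEq] at hk
        exact Prod.ext (by simpa using hk.1) hk.2)
      simp [alpha, lp.single_apply, hl, this]
  rw [star_apply_coord, h, lp.inner_single_left]
  simp [mul_comm]

theorem star_beta_bound (hq : |q| < 1) : ∃ C, ∀ k : ℕ × ℤ, ‖((q ^ k.1 : ℝ) : ℂ)‖ ≤ C :=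
  ⟨1, fun k => by
    rw [Complex.norm_real, Real.norm_eq_abs, abs_pow]
    exact pow_le_one₀ (abs_nonneg q) hq.le⟩

theorem star_beta : star (beta q hq) = weighted _ shiftZ_neg_injective
    (fun k => ((q ^ k.1 : ℝ) : ℂ)) (star_beta_bound hq) := by
  refine (star_weighted_shiftZ _ ?_).trans ?_
  · simpa using star_beta_bound hq
  · ext x k; simp

theorem sqrt_mul_self_one_sub (hq : |q| < 1) (i : ℕ) :
    (Real.sqrt (1 - q ^ (2 * (i + 1))) : ℂ) * (Real.sqrt (1 - q ^ (2 * (i + 1))) : ℂ) =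
      1 - (q : ℂ) ^ (2 * (i + 1)) := by
  have h : q ^ (2 * (i + 1)) ≤ 1 := by
    rw [pow_mul]
    exact pow_le_one₀ (sq_nonneg q) ((sq_le_one_iff_abs_le_one q).2 hq.le)
  rw [← Complex.ofReal_mul, Real.mul_self_sqrt (by linarith)]
  push_cast
  rfl

/-- Both products are diagonal, with entries `1 - q^(2(i+1))` and `1 - q^(2i)`; the second formula
also covers `i = 0`, where it vanishes. -/
theorem alpha_relation : alphaAf q hq * star (alphaAf q hq) -
    (q : ℂ) ^ 2 • (star (alphaAf q hq) * alphaAf q hq) = (1 - (q : ℂ) ^ 2) • 1 := by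
  refine Subtype.ext ?_
  change alpha q * star (alpha q) - (q : ℂ) ^ 2 • (star (alpha q) * alpha q) =
    (1 - (q : ℂ) ^ 2) • (1 : Hilb →L[ℂ] Hilb)
  ext x ⟨i, j⟩
  have h1 : (alpha q) (star (alpha q) x) (i, j) = (1 - (q : ℂ) ^ (2 * (i + 1))) * x (i, j) := by
    rw [← sqrt_mul_self_one_sub hq, mul_assoc, ← star_alpha_apply_succ]
    rfl
  have h2 : star (alpha q) (alpha q x) (i, j) = (1 - (q : ℂ) ^ (2 * i)) * x (i, j) := by
    cases i with
    | zero => simp [star_alpha_apply_zero]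
    | succ i =>
      rw [← sqrt_mul_self_one_sub hq, star_alpha_apply_succ, mul_assoc]
      rfl
  simp only [sub_apply, smul_apply, mul_apply_eq_comp, lp.coeFn_sub, lp.coeFn_smul, Pi.sub_apply,
    Pi.smul_apply, h1, h2, smul_eq_mul, one_apply_eq_self]
  ring

/-! ### The sign operator and the commutators with `D` modulo compact operators -/

theorem signOp_mul_signOp : signOp * signOp = 1 := by
  ext x k
  simp only [mul_apply_eq_comp, signOp_apply, sgn, one_apply_eq_self]
  split_ifs <;> simp

theorem signOp_commute_alpha : Commute signOp (alpha q) := by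
  ext x k
  simp [alpha]
  ring

theorem signOp_commute_star_alpha : Commute signOp (star (alpha q)) := by
  ext x ⟨i, j⟩
  cases i with
  | zero => simp [star_alpha_apply_zero]
  | succ i => simp [star_alpha_apply_succ]; ring

theorem tendsto_pow_zero (hq : |q| < 1) : Tendsto (fun i : ℕ => ((q ^ i : ℝ) : ℂ)) atTop (𝓝 0) :=
  (Complex.continuous_ofReal.tendsto' 0 0 Complex.ofReal_zero).comp
    (tendsto_pow_atTop_nhds_zero_of_abs_lt_one hq)

theorem tendsto_mul_pow_zero (hq : |q| < 1) :
    Tendsto (fun i : ℕ => ((i * q ^ i : ℝ) : ℂ)) atTop (𝓝 0) :=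
  (Complex.continuous_ofReal.tendsto' 0 0 Complex.ofReal_zero).comp
    (tendsto_self_mul_const_pow_of_abs_lt_one hq)

theorem tendsto_mul_cofinite {g : ℤ → ℂ} {r : ℕ → ℂ} {j₀ : ℤ} (hg : ∀ j, j ≠ j₀ → g j = 0)
    (hr : Tendsto r atTop (𝓝 0)) :
    Tendsto (fun k : ℕ × ℤ => g k.2 * r k.1) cofinite (𝓝 0) := by
  refine tendsto_cofinite_of_row (j₀ := j₀) (fun i j hj => ?_) ?_
  · change g j * r i = 0
    rw [hg j hj, zero_mul]
  · have h := hr.const_mul (g j₀)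
    rwa [mul_zero] at h

theorem exists_bound_of_tendsto_cofinite {w : ℕ × ℤ → ℂ} (h : Tendsto w cofinite (𝓝 0)) :
    ∃ C, ∀ k, ‖w k‖ ≤ C := by
  obtain ⟨C, hC⟩ := h.norm.bddAbove_range_of_cofinite
  exact ⟨C, fun k => hC ⟨k, rfl⟩⟩

/-- An operator which acts as a weighted composition with weights tending to zero is compact. -/
theorem isCompactOperator_of_apply {T : Hilb →L[ℂ] Hilb} {f : ℕ × ℤ → ℕ × ℤ}
    (hf : Function.Injective f) {w : ℕ × ℤ → ℂ} (h : Tendsto w cofinite (𝓝 0))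
    (hT : ∀ x k, T x k = w k * x (f k)) : IsCompactOperator T := by
  have : T = weighted f hf w (exists_bound_of_tendsto_cofinite h) := by
    ext x k; exact hT x k
  rw [this]
  exact isCompactOperator_weighted hf _ h

theorem sgn_sub_succ {j : ℤ} (hj : j ≠ -1) : ((sgn j - sgn (j + 1) : ℝ) : ℂ) = 0 := by
  have : (0 ≤ j) ↔ 0 ≤ j + 1 := by omega
  simp only [sgn, this, sub_self, Complex.ofReal_zero]

theorem sgn_sub_pred {j : ℤ} (hj : j ≠ 0) : ((sgn j - sgn (j - 1) : ℝ) : ℂ) = 0 := by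
  have : (0 ≤ j) ↔ 0 ≤ j - 1 := by omega
  simp only [sgn, this, sub_self, Complex.ofReal_zero]

/-- The signs at `j` and `j + 1` differ only for `j = -1`, so the commutator lives on one row and
has weights proportional to `q^i` there. -/
theorem theta_signOp_beta :
    theta signOp * theta (beta q hq) = theta (beta q hq) * theta signOp := by
  rw [← map_mul, ← map_mul, theta_eq_iff]
  refine isCompactOperator_of_apply shiftZ_injective
    (tendsto_mul_cofinite (g := fun j => ((sgn j - sgn (j + 1) : ℝ) : ℂ))
      (fun _ => sgn_sub_succ) (tendsto_pow_zero hq)) fun x k => ?_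
  simp only [sub_apply, lp.coeFn_sub, Pi.sub_apply, mul_apply_eq_comp, signOp_apply, beta,
    weighted_apply, Complex.ofReal_sub]
  ring

theorem theta_signOp_star_beta :
    theta signOp * theta (star (beta q hq)) = theta (star (beta q hq)) * theta signOp := by
  rw [← map_mul, ← map_mul, theta_eq_iff, star_beta]
  refine isCompactOperator_of_apply shiftZ_neg_injective
    (tendsto_mul_cofinite (g := fun j => ((sgn j - sgn (j - 1) : ℝ) : ℂ))
      (fun _ => sgn_sub_pred) (tendsto_pow_zero hq)) fun x k => ?_
  simp only [sub_apply, lp.coeFn_sub, Pi.sub_apply, mul_apply_eq_comp, signOp_apply,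
    weighted_apply, Complex.ofReal_sub]
  ring

theorem isCommutator_alpha : IsCommutator dirac (alpha q) (-(signOp * alpha q)) := by
  rw [isCommutator_iff]
  intro x k
  simp [alpha, dirac_apply, diracEig]
  ring

theorem comm_alphaAf : comm q hq (alphaAf q hq) = -(signOp * alpha q) :=
  (comm_spec q hq _).unique isCommutator_alpha

theorem star_signOp : star signOp = signOp := by
  ext x k
  have h : signOp (lp.single 2 k 1) = lp.single 2 k (sgn k.2 : ℂ) := by
    ext l
    by_cases hl : l = k
    · subst hl; simp
    · simp [lp.single_apply, hl]
  rw [star_apply_coord, h, lp.inner_single_left]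
  simp [mul_comm]

theorem comm_star_alphaAf : comm q hq (star (alphaAf q hq)) = signOp * star (alpha q) := by
  refine (comm_spec q hq _).unique ?_
  have h := (isCommutator_alpha (q := q)).star
  rw [star_neg, neg_neg, star_mul, star_signOp, ← signOp_commute_star_alpha.eq] at h
  exact h

/-- The eigenvalue difference of `D` between `(i, j)` and `(i, j + 1)` is `-1 + i (sgn j - sgn (j +
1))`. The first term gives `-β`; the second is supported on the row `j = -1` with weight
proportional to `i q^i`, hence compact. -/
theorem theta_comm_betaAf : theta (comm q hq (betaAf q hq)) = -theta (beta q hq) := by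
  have hw := tendsto_mul_cofinite (g := fun j => ((sgn j - sgn (j + 1) : ℝ) : ℂ))
    (fun _ => sgn_sub_succ) (tendsto_mul_pow_zero hq)
  have h : comm q hq (betaAf q hq) =
      -beta q hq + weighted _ shiftZ_injective _ (exists_bound_of_tendsto_cofinite hw) := by
    refine (comm_spec q hq _).unique ?_
    change IsCommutator dirac (beta q hq) _
    rw [isCommutator_iff]
    intro x k
    simp only [add_apply, neg_apply, lp.coeFn_add, lp.coeFn_neg, Pi.add_apply, Pi.neg_apply, beta,
      weighted_apply, dirac_apply, diracEig]
    push_cast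
    ring
  rw [← map_neg, theta_eq_iff, h, add_sub_cancel_left]
  exact isCompactOperator_weighted _ _ hw

theorem theta_comm_star_betaAf :
    theta (comm q hq (star (betaAf q hq))) = theta (star (beta q hq)) := by
  have hw := tendsto_mul_cofinite (g := fun j => ((sgn j - sgn (j - 1) : ℝ) : ℂ))
    (fun _ => sgn_sub_pred) (tendsto_mul_pow_zero hq)
  have h : comm q hq (star (betaAf q hq)) =
      star (beta q hq) +
        weighted _ shiftZ_neg_injective _ (exists_bound_of_tendsto_cofinite hw) := by
    refine (comm_spec q hq _).unique ?_
    change IsCommutator dirac (star (beta q hq)) _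
    rw [isCommutator_iff, star_beta]
    intro x k
    simp only [add_apply, lp.coeFn_add, Pi.add_apply, weighted_apply, dirac_apply, diracEig]
    push_cast
    ring
  rw [theta_eq_iff, h, add_sub_cancel_left]
  exact isCompactOperator_weighted _ _ hw

/-! ### Boundaries of the junk forms -/

section Boundary

open UnivForms

variable {A : Type*} [Ring A] [Algebra ℂ A] {B : Type*} [Ring B] [Algebra ℂ B]
  (ψ : UnivForms A →ₐ[ℂ] B)

/-- The image `ψ (δ Jₙ)`. -/
def boundary (n : ℕ) : Submodule ℂ B :=
  (kerDeg ψ n).map (ψ.toLinearMap ∘ₗ delta)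

variable {ψ}

theorem mem_boundary {n : ℕ} {x : B} :
    x ∈ boundary ψ n ↔ ∃ μ ∈ kerDeg ψ n, ψ (delta μ) = x := Iff.rfl

theorem mem_kerDeg {n : ℕ} {ω : UnivForms A} : ω ∈ kerDeg ψ n ↔ ω ∈ deg A n ∧ ψ ω = 0 := Iff.rfl

/-- The second Leibniz term `δa · μ` is killed by `ψ` because `ψ μ = 0`; the same mechanism serves
for multiplication on the right. -/
theorem of_mul_mem_boundary (a : A) {n : ℕ} {x : B} (h : x ∈ boundary ψ n) :
    ψ (of a) * x ∈ boundary ψ n := by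
  obtain ⟨μ, hμ, rfl⟩ := mem_boundary.1 h
  refine mem_boundary.2 ⟨of a * μ, of_mul_mem_kerDeg ψ a hμ, ?_⟩
  rw [delta_mul, map_add, map_mul ψ (delta _) μ, (mem_kerDeg.1 hμ).2, mul_zero, add_zero,
    parity_of, map_mul]

theorem psi_parity_eq_zero {n : ℕ} {μ : UnivForms A} (hμ : μ ∈ kerDeg ψ n) :
    ψ (parity μ) = 0 := by
  rw [parity_eq hμ.1, map_smul, (mem_kerDeg.1 hμ).2, smul_zero]

theorem mul_of_mem_boundary (a : A) {n : ℕ} {x : B} (h : x ∈ boundary ψ n) :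
    x * ψ (of a) ∈ boundary ψ n := by
  obtain ⟨μ, hμ, rfl⟩ := mem_boundary.1 h
  refine mem_boundary.2 ⟨μ * of a, mul_of_mem_kerDeg ψ a hμ, ?_⟩
  rw [delta_mul, map_add, map_mul ψ (parity μ), psi_parity_eq_zero hμ, zero_mul, zero_add,
    map_mul]

theorem mul_dgen_mem_boundary (a : A) {n : ℕ} {x : B} (h : x ∈ boundary ψ n) :
    x * ψ (dgen a) ∈ boundary ψ (n + 1) := by
  obtain ⟨μ, hμ, rfl⟩ := mem_boundary.1 h
  refine mem_boundary.2 ⟨μ * dgen a, mul_dgen_mem_kerDeg ψ a hμ, ?_⟩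
  rw [delta_mul, map_add, map_mul ψ (parity μ), psi_parity_eq_zero hμ, zero_mul, zero_add,
    map_mul]

/-- If every form of degree `2` is, under `ψ`, the boundary of a form of degree `1` in the kernel,
then the same holds in all degrees `n ≥ 2`. -/
theorem mem_boundary_of_deg (h : ∀ ω ∈ deg A 2, ψ ω ∈ boundary ψ 1) (n : ℕ) {ω : UnivForms A}
    (hω : ω ∈ deg A (n + 2)) : ψ ω ∈ boundary ψ (n + 1) := by
  induction n generalizing ω with
  | zero => exact h ω hω
  | succ n ih =>
    refine deg_succ_induction (P := fun ω => ψ ω ∈ boundary ψ (n + 1 + 1)) ?_ ?_ ?_ ?_ hω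
    · rw [map_zero]; exact zero_mem _
    · intro x y hx hy; rw [map_add]; exact add_mem hx hy
    · intro c x hx; rw [map_smul]; exact Submodule.smul_mem _ _ hx
    · intro x hx a; rw [map_mul]; exact mul_dgen_mem_boundary a (ih hx)

/-- If `ψ ω = ψ (δμ)` with `μ` in the kernel, then `ω = (ω - δμ) + δμ` is a junk form. -/
theorem subsingleton_forms {n : ℕ} (h : ∀ ω ∈ deg A (n + 1), ψ ω ∈ boundary ψ n) :
    Subsingleton (Forms ψ (n + 1)) := by
  have key : ∀ ω ∈ deg A (n + 1), ω ∈ junk ψ (n + 1) := fun ω hω => by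
    obtain ⟨μ, hμ, e⟩ := mem_boundary.1 (h ω hω)
    rw [← sub_add_cancel ω (delta μ)]
    refine Submodule.add_mem_sup (mem_kerDeg.2 ⟨sub_mem hω (delta_mem_deg hμ.1), ?_⟩) ⟨μ, hμ, rfl⟩
    rw [map_sub, e, sub_self]
  refine ⟨fun x y => ?_⟩
  obtain ⟨ω, rfl⟩ := Forms.mk_surjective _ _ x
  obtain ⟨ω', rfl⟩ := Forms.mk_surjective _ _ y
  exact (Submodule.Quotient.eq _).2 (key _ (ω - ω').2)

theorem delta_of_mul (a : A) (x : UnivForms A) :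
    delta (of a * x) = of a * delta x + dgen a * x := by
  rw [delta_mul, parity_of, delta_of]

theorem delta_mul_of (a : A) {x : UnivForms A} (hx : x ∈ deg A 1) :
    delta (x * of a) = delta x * of a - x * dgen a := by
  rw [delta_mul, parity_eq hx, delta_of, pow_one, neg_smul, one_smul, neg_mul, neg_add_eq_sub]

theorem delta_of_mul_dgen (a b : A) : delta (of a * dgen b) = dgen a * dgen b := by
  rw [delta_of_mul, delta_dgen, mul_zero, zero_add]

theorem delta_dgen_mul_of (a b : A) : delta (dgen a * of b) = -(dgen a * dgen b) := by
  rw [delta_mul, parity_dgen, delta_of, delta_dgen, zero_mul, add_zero, neg_mul]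

end Boundary

/-! ### Auxiliary identities -/

section Identities

variable {R : Type*} [Ring R]

theorem mul_commute_mul {s b c : R} (hs : s * s = 1) (hb : Commute s b) :
    s * b * (s * c) = b * c := by
  rw [hb.eq, mul_assoc, ← mul_assoc s, hs, one_mul]

theorem add_mul_add_of_commute {s b c b' c' : R} (hs : s * s = 1) (hb : Commute s b)
    (hc : Commute s c) :
    (s * b + c) * (s * b' + c') = (b * b' + c * c') + s * (b * c' + c * b') := by
  have h : c * (s * b') = s * (c * b') := by rw [← mul_assoc, ← hc.eq, mul_assoc]
  rw [add_mul, mul_add, mul_add, mul_commute_mul hs hb, h, mul_add, mul_assoc]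
  abel

/-- Moving `y` past `x` twice. With `x = α`, `y = α*`, `c = q²`, this recovers `α` from `α²` inside
a bimodule. -/
theorem q_relation_sq [Algebra ℂ R] {x y : R} {c : ℂ} (h : x * y - c • (y * x) = (1 - c) • 1) :
    x * x * y - c ^ 2 • (y * (x * x)) = (1 - c ^ 2) • x := by
  rw [sub_eq_iff_eq_add] at h
  rw [mul_assoc, h, mul_add, mul_smul_comm, mul_smul_comm, ← mul_assoc x y x, h, mul_one, add_mul,
    smul_mul_assoc, smul_mul_assoc, one_mul, mul_assoc y]
  module

end Identities

/-! ### The image of the one-forms -/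

section OneForms

open UnivForms

/-- The map `𝒜_f → 𝓠(𝓗)`. -/
noncomputable def thetaAf (q : ℝ) (hq : |q| < 1) : Af q hq →ₐ[ℂ] Calkin :=
  theta.comp (Af q hq).subtype.toAlgHom

theorem psi_of (a : Af q hq) : psi q hq (of a) = thetaAf q hq a :=
  congrArg theta (lift_of _ _ _ a)

theorem psi_dgen (a : Af q hq) : psi q hq (dgen a) = theta (comm q hq a) :=
  congrArg theta (lift_dgen _ _ _ a)

theorem psi_dgen_alpha :
    psi q hq (dgen (alphaAf q hq)) = -(theta signOp * thetaAf q hq (alphaAf q hq)) := by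
  rw [psi_dgen, comm_alphaAf, map_neg, map_mul]; rfl

theorem psi_dgen_star_alpha : psi q hq (dgen (star (alphaAf q hq))) =
    theta signOp * thetaAf q hq (star (alphaAf q hq)) := by
  rw [psi_dgen, comm_star_alphaAf, map_mul]; rfl

theorem psi_dgen_beta :
    psi q hq (dgen (betaAf q hq)) = -thetaAf q hq (betaAf q hq) := by
  rw [psi_dgen, theta_comm_betaAf]; rfl

theorem psi_dgen_star_beta : psi q hq (dgen (star (betaAf q hq))) =
    thetaAf q hq (star (betaAf q hq)) := by
  rw [psi_dgen, theta_comm_star_betaAf]; rfl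

theorem theta_signOp_sq : theta signOp * theta signOp = 1 := by
  rw [← map_mul, signOp_mul_signOp, map_one]

/-- The commutant is an algebra, so the generators and their adjoints suffice. -/
theorem theta_signOp_commute (a : Af q hq) : Commute (theta signOp) (thetaAf q hq a) := by
  induction a using Af_induction with
  | hα => exact signOp_commute_alpha.map theta
  | hβ => exact theta_signOp_beta (hq := hq)
  | hα' => exact signOp_commute_star_alpha.map theta
  | hβ' => exact theta_signOp_star_beta (hq := hq)
  | halg c => rw [map_smul, map_one]; exact (Commute.one_right _).smul_right c
  | hadd a b ha hb => rw [map_add]; exact ha.add_right hb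
  | hmul a b ha hb => rw [map_mul]; exact ha.mul_right hb

/-- The element `θ((I ⊗ S) b + c)` of the Calkin algebra. -/
noncomputable def symbol (q : ℝ) (hq : |q| < 1) (p : Af q hq × idealBeta q hq) : Calkin :=
  theta signOp * thetaAf q hq p.1 + thetaAf q hq (p.2 : Af q hq)

theorem symbol_add (p r : Af q hq × idealBeta q hq) :
    symbol q hq (p + r) = symbol q hq p + symbol q hq r := by
  change theta signOp * thetaAf q hq (p.1 + r.1) + thetaAf q hq ((p.2 : Af q hq) + r.2) = _
  rw [map_add, map_add, symbol, symbol]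
  noncomm_ring

theorem symbol_smul (a : Af q hq) (p : Af q hq × idealBeta q hq) :
    symbol q hq (a • p) = thetaAf q hq a * symbol q hq p := by
  change theta signOp * thetaAf q hq (a * p.1) + thetaAf q hq (a * (p.2 : Af q hq)) = _
  rw [map_mul, map_mul, symbol, mul_add, ← mul_assoc, ← mul_assoc, (theta_signOp_commute a).eq]

theorem symbol_op_smul (a : Af q hq) (p : Af q hq × idealBeta q hq) :
    symbol q hq (MulOpposite.op a • p) = symbol q hq p * thetaAf q hq a := by
  change theta signOp * thetaAf q hq (p.1 * a) + thetaAf q hq ((p.2 : Af q hq) * a) = _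
  rw [map_mul, map_mul, symbol, add_mul, mul_assoc]

theorem thetaAf_pair_eq_zero {b c : Af q hq}
    (h : theta signOp * thetaAf q hq b + thetaAf q hq c = 0) : b = 0 ∧ c = 0 := by
  refine eq_zero_of_isCompactOperator ?_
  have h1 : theta (signOp * b + c : Hilb →L[ℂ] Hilb) = theta 0 := by
    rw [map_add, map_mul, map_zero]; exact h
  rw [theta_eq_iff, sub_zero] at h1
  exact h1

theorem symbol_injective : Function.Injective (symbol q hq) := by
  intro p r h
  have h1 := thetaAf_pair_eq_zero (b := p.1 - r.1) (c := (p.2 : Af q hq) - r.2) (by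
    rw [map_sub, map_sub, mul_sub]
    rw [symbol, symbol] at h
    rw [← sub_eq_zero] at h
    rw [← h]
    abel)
  exact Prod.ext (sub_eq_zero.1 h1.1) (Subtype.ext (sub_eq_zero.1 h1.2))

/-- The case `b = 0` of the uniqueness of symbols: `θ` is injective on `𝒜_f`. Hence `δJ₀`
contributes nothing in degree one. -/
theorem kerDeg_zero : kerDeg (psi q hq) 0 = ⊥ := by
  refine (Submodule.eq_bot_iff _).2 fun ω hω => ?_
  obtain ⟨h0, h⟩ := mem_kerDeg.1 hω
  obtain ⟨a, rfl⟩ := mem_deg_zero.1 h0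
  rw [psi_of] at h
  rw [(thetaAf_pair_eq_zero (b := 0) (c := a) (by rw [map_zero, mul_zero, zero_add, h])).2,
    map_zero]

theorem junk_one : junk (psi q hq) 1 = kerDeg (psi q hq) 1 := by
  change kerDeg (psi q hq) 1 ⊔ (kerDeg (psi q hq) 0).map delta = _
  rw [kerDeg_zero, Submodule.map_bot, sup_bot_eq]

theorem beta_mem : betaAf q hq ∈ idealBeta q hq := TwoSidedIdeal.subset_span (by simp)

theorem star_beta_mem : star (betaAf q hq) ∈ idealBeta q hq := TwoSidedIdeal.subset_span (by simp)

set_option maxHeartbeats 1000000 in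
-- Symbols form an `𝒜_f`-bimodule, so the Leibniz rule reduces the claim to the generators and their
-- adjoints; `β` and `β*` contribute only to the component in `ℐ_β`.
theorem exists_symbol_dgen (a : Af q hq) : ∃ p, psi q hq (dgen a) = symbol q hq p := by
  induction a using Af_induction with
  | hα => exact ⟨(-alphaAf q hq, 0), by simp [psi_dgen_alpha, symbol]⟩
  | hβ =>
    exact ⟨(0, ⟨-betaAf q hq, (idealBeta q hq).neg_mem beta_mem⟩), by simp [psi_dgen_beta, symbol]⟩
  | hα' => exact ⟨(star (alphaAf q hq), 0), by simp [psi_dgen_star_alpha, symbol]⟩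
  | hβ' => exact ⟨(0, ⟨star (betaAf q hq), star_beta_mem⟩), by simp [psi_dgen_star_beta, symbol]⟩
  | halg c =>
    have h : dgen (1 : Af q hq) = 0 := by simpa using dgen_mul (1 : Af q hq) 1
    exact ⟨0, by simp [h, symbol]⟩
  | hadd a b ha hb =>
    obtain ⟨p, hp⟩ := ha
    obtain ⟨r, hr⟩ := hb
    exact ⟨p + r, by rw [map_add, map_add, hp, hr, symbol_add]⟩
  | hmul a b ha hb =>
    obtain ⟨p, hp⟩ := ha
    obtain ⟨r, hr⟩ := hb
    refine ⟨a • r + MulOpposite.op b • p, ?_⟩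
    rw [dgen_mul, map_add, map_mul, map_mul, psi_of a, psi_of b, hp, hr, symbol_add, symbol_smul,
      symbol_op_smul]

theorem exists_symbol {ω : UnivForms (Af q hq)} (hω : ω ∈ deg (Af q hq) 1) :
    ∃ p, psi q hq ω = symbol q hq p := by
  refine deg_succ_induction (P := fun ω => ∃ p, psi q hq ω = symbol q hq p) ?_ ?_ ?_ ?_ hω
  · exact ⟨0, by simp [symbol]⟩
  · rintro x y ⟨p, hp⟩ ⟨r, hr⟩
    exact ⟨p + r, by rw [map_add, hp, hr, symbol_add]⟩
  · rintro c x ⟨p, hp⟩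
    refine ⟨(c • 1 : Af q hq) • p, ?_⟩
    rw [symbol_smul, map_smul, map_smul, map_one, hp, smul_mul_assoc, one_mul]
  · intro x hx a
    obtain ⟨b, rfl⟩ := mem_deg_zero.1 hx
    obtain ⟨p, hp⟩ := exists_symbol_dgen a
    exact ⟨b • p, by rw [map_mul, psi_of, hp, symbol_smul]⟩

/-- The one-form `(1 - q²)⁻¹ (α δα* + q² α* δα)`. -/
noncomputable def signForm (q : ℝ) (hq : |q| < 1) : UnivForms (Af q hq) :=
  (1 - (q : ℂ) ^ 2)⁻¹ • (of (alphaAf q hq) * dgen (star (alphaAf q hq)) +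
    (q : ℂ) ^ 2 • (of (star (alphaAf q hq)) * dgen (alphaAf q hq)))

theorem of_mul_dgen_mem_deg (a b : Af q hq) : of a * dgen b ∈ deg (Af q hq) 1 :=
  mul_dgen_mem_deg b (mem_deg_zero.2 ⟨a, rfl⟩)

theorem dgen_mem_deg (a : Af q hq) : dgen a ∈ deg (Af q hq) 1 := by
  simpa using of_mul_dgen_mem_deg 1 a

theorem signForm_mem_deg : signForm q hq ∈ deg (Af q hq) 1 :=
  Submodule.smul_mem _ _ (add_mem (of_mul_dgen_mem_deg _ _)
    (Submodule.smul_mem _ _ (of_mul_dgen_mem_deg _ _)))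

theorem one_sub_pow_ne_zero (hq : |q| < 1) {n : ℕ} (hn : n ≠ 0) : 1 - (q : ℂ) ^ n ≠ 0 := by
  have h := pow_lt_one₀ (abs_nonneg q) hq hn
  rw [sub_ne_zero]
  intro h1
  have h2 := congrArg norm h1
  rw [norm_pow, Complex.norm_real, Real.norm_eq_abs, norm_one] at h2
  linarith

/-- The opposite signs of `[D, α]` and `[D, α*]` turn the sum into `F (αα* - q² α*α)`, which is `(1
- q²) F` by the relation for `α`. -/
theorem psi_signForm : psi q hq (signForm q hq) = theta signOp := by
  have h := congrArg (thetaAf q hq) (alpha_relation (q := q) (hq := hq))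
  simp only [map_sub, map_mul, map_smul, map_one] at h
  have c1 := (theta_signOp_commute (alphaAf q hq)).eq
  have c2 := (theta_signOp_commute (star (alphaAf q hq))).eq
  rw [signForm, map_smul, map_add, map_smul, map_mul, map_mul, psi_of, psi_of, psi_dgen_alpha,
    psi_dgen_star_alpha, mul_neg, ← mul_assoc, ← mul_assoc, ← c1, ← c2, mul_assoc, mul_assoc,
    smul_neg, ← sub_eq_add_neg, ← mul_smul_comm, ← mul_sub, h, mul_smul_comm, mul_one, smul_smul,
    inv_mul_cancel₀ (one_sub_pow_ne_zero hq two_ne_zero), one_smul]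

/-- The elements attained form a sub-bimodule, which contains `β` and `β*` through `-δβ` and `δβ*`.
-/
theorem exists_form_ideal {c : Af q hq} (hc : c ∈ idealBeta q hq) :
    ∃ ω ∈ deg (Af q hq) 1, psi q hq ω = thetaAf q hq c := by
  induction hc using TwoSidedIdeal.span_induction with
  | mem x hx =>
    rcases hx with rfl | rfl
    · exact ⟨-dgen _, neg_mem (dgen_mem_deg _), by rw [map_neg, psi_dgen_beta, neg_neg]⟩
    · exact ⟨dgen _, dgen_mem_deg _, psi_dgen_star_beta⟩
  | zero => exact ⟨0, zero_mem _, by simp⟩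
  | add x y _ _ hx hy =>
    obtain ⟨ω, h, e⟩ := hx
    obtain ⟨ω', h', e'⟩ := hy
    exact ⟨ω + ω', add_mem h h', by rw [map_add, map_add, e, e']⟩
  | neg x _ hx =>
    obtain ⟨ω, h, e⟩ := hx
    exact ⟨-ω, neg_mem h, by rw [map_neg, map_neg, e]⟩
  | left_absorb a x _ hx =>
    obtain ⟨ω, h, e⟩ := hx
    exact ⟨of a * ω, of_mul_mem_deg a h, by rw [map_mul, map_mul, e, psi_of]⟩
  | right_absorb a x _ hx =>
    obtain ⟨ω, h, e⟩ := hx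
    exact ⟨ω * of a, mul_of_mem_deg a h, by rw [map_mul, map_mul, e, psi_of]⟩

theorem exists_form (p : Af q hq × idealBeta q hq) :
    ∃ ω ∈ deg (Af q hq) 1, psi q hq ω = symbol q hq p := by
  obtain ⟨ω, h, e⟩ := exists_form_ideal p.2.2
  refine ⟨signForm q hq * of p.1 + ω, add_mem (mul_of_mem_deg _ signForm_mem_deg) h, ?_⟩
  rw [map_add, map_mul, e, psi_signForm, psi_of, symbol]

/-! ### The bimodule isomorphism in degree one -/

theorem mk_eq_mk_iff {ω ω' : deg (Af q hq) 1} :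
    Forms.mk (psi q hq) 1 ω = Forms.mk (psi q hq) 1 ω' ↔ psi q hq ω = psi q hq ω' := by
  refine (Submodule.Quotient.eq _).trans ?_
  change (ω - ω' : UnivForms (Af q hq)) ∈ junk (psi q hq) 1 ↔ _
  rw [junk_one, mem_kerDeg, map_sub, sub_eq_zero]
  exact and_iff_right (Submodule.sub_mem _ ω.2 ω'.2)

theorem exists_symbol_class (x : OmegaD q hq 1) :
    ∃ p, ∀ ω, Forms.mk (psi q hq) 1 ω = x → psi q hq ω = symbol q hq p := by
  obtain ⟨ω, rfl⟩ := Forms.mk_surjective _ _ x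
  obtain ⟨p, hp⟩ := exists_symbol ω.2
  exact ⟨p, fun ω' h => (mk_eq_mk_iff.1 h).trans hp⟩

/-- The pair `(b, c)` with `ψ(ω) = θ((I ⊗ S) b + c)`, as a function of the class of `ω`. -/
noncomputable def classSymbol (x : OmegaD q hq 1) : Af q hq × idealBeta q hq :=
  (exists_symbol_class x).choose

theorem symbol_classSymbol (ω : deg (Af q hq) 1) :
    symbol q hq (classSymbol (Forms.mk (psi q hq) 1 ω)) = psi q hq ω :=
  ((exists_symbol_class _).choose_spec ω rfl).symm

theorem classSymbol_add (x y : OmegaD q hq 1) :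
    classSymbol (x + y) = classSymbol x + classSymbol y := by
  obtain ⟨ω, rfl⟩ := Forms.mk_surjective _ _ x
  obtain ⟨ω', rfl⟩ := Forms.mk_surjective _ _ y
  refine symbol_injective ?_
  rw [symbol_add, ← map_add, symbol_classSymbol, symbol_classSymbol, symbol_classSymbol]
  exact map_add (psi q hq) _ _

set_option maxHeartbeats 1000000 in
theorem classSymbol_smul (a : Af q hq) (x : OmegaD q hq 1) :
    classSymbol (a • x) = a • classSymbol x := by
  obtain ⟨ω, rfl⟩ := Forms.mk_surjective _ _ x
  refine symbol_injective ?_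
  rw [symbol_smul, symbol_classSymbol, ← psi_of a, ← map_mul]
  exact symbol_classSymbol ⟨of a * ω.1, of_mul_mem_deg a ω.2⟩

set_option maxHeartbeats 1000000 in
theorem classSymbol_op_smul (a : Af q hq) (x : OmegaD q hq 1) :
    classSymbol (MulOpposite.op a • x) = MulOpposite.op a • classSymbol x := by
  obtain ⟨ω, rfl⟩ := Forms.mk_surjective _ _ x
  refine symbol_injective ?_
  rw [symbol_op_smul, symbol_classSymbol, ← psi_of a, ← map_mul]
  exact symbol_classSymbol ⟨ω.1 * of a, mul_of_mem_deg a ω.2⟩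

theorem classSymbol_bijective : Function.Bijective (classSymbol (q := q) (hq := hq)) := by
  refine ⟨fun x y h => ?_, fun p => ?_⟩
  · obtain ⟨ω, rfl⟩ := Forms.mk_surjective _ _ x
    obtain ⟨ω', rfl⟩ := Forms.mk_surjective _ _ y
    refine mk_eq_mk_iff.2 ?_
    rw [← symbol_classSymbol, ← symbol_classSymbol, h]
  · obtain ⟨ω, h, e⟩ := exists_form p
    exact ⟨Forms.mk (psi q hq) 1 ⟨ω, h⟩, symbol_injective ((symbol_classSymbol _).trans e)⟩

/-- The isomorphism of left modules `Ω_d¹(𝒜_f) ≃ 𝒜_f ⊕ ℐ_β`. -/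
noncomputable def oneFormsEquiv (q : ℝ) (hq : |q| < 1) :
    OmegaD q hq 1 ≃ₗ[Af q hq] (Af q hq × idealBeta q hq) :=
  LinearEquiv.ofBijective
    ({ toFun := classSymbol
       map_add' := classSymbol_add
       map_smul' := classSymbol_smul } : OmegaD q hq 1 →ₗ[Af q hq] (Af q hq × idealBeta q hq))
    classSymbol_bijective

/-! ### The two-forms -/

theorem thetaAf_mul_mem_boundary (a : Af q hq) {y : Calkin} (hy : y ∈ boundary (psi q hq) 1) :
    thetaAf q hq a * y ∈ boundary (psi q hq) 1 := by
  rw [← psi_of a]; exact of_mul_mem_boundary a hy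

theorem mul_thetaAf_mem_boundary (a : Af q hq) {y : Calkin} (hy : y ∈ boundary (psi q hq) 1) :
    y * thetaAf q hq a ∈ boundary (psi q hq) 1 := by
  rw [← psi_of a]; exact mul_of_mem_boundary a hy

theorem psi_dgen_alpha_mul_self : psi q hq (dgen (alphaAf q hq)) * psi q hq (dgen (alphaAf q hq)) =
    thetaAf q hq (alphaAf q hq) * thetaAf q hq (alphaAf q hq) := by
  rw [psi_dgen_alpha, neg_mul_neg]
  exact mul_commute_mul theta_signOp_sq (theta_signOp_commute _)

theorem alpha_sq_mem_boundary :
    thetaAf q hq (alphaAf q hq) * thetaAf q hq (alphaAf q hq) ∈ boundary (psi q hq) 1 := by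
  have hμ : dgen (alphaAf q hq) * of (alphaAf q hq) - of (alphaAf q hq) * dgen (alphaAf q hq) ∈
      kerDeg (psi q hq) 1 := by
    refine mem_kerDeg.2 ⟨Submodule.sub_mem _ (mul_of_mem_deg _ (dgen_mem_deg _))
      (of_mul_dgen_mem_deg _ _), ?_⟩
    rw [map_sub, map_mul, map_mul, psi_of, psi_dgen_alpha, neg_mul, mul_neg, ← mul_assoc,
      ← (theta_signOp_commute (alphaAf q hq)).eq, sub_self]
  -- The differential of `δα α - α δα` is `-2 δα δα`, whose image is `-2α²`.
  have h := Submodule.smul_mem _ (-2⁻¹ : ℂ) (mem_boundary.2 ⟨_, hμ, rfl⟩)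
  rw [map_sub, delta_of_mul_dgen, delta_dgen_mul_of, map_sub, map_neg, map_mul,
    psi_dgen_alpha_mul_self] at h
  convert h using 1
  module

theorem alpha_mem_boundary : thetaAf q hq (alphaAf q hq) ∈ boundary (psi q hq) 1 := by
  have h := congrArg (thetaAf q hq) (q_relation_sq (alpha_relation (q := q) (hq := hq)))
  rw [map_sub, map_smul, map_smul, map_mul, map_mul _ (star _), map_mul, ← pow_mul] at h
  have h1 : (1 - (q : ℂ) ^ (2 * 2)) • thetaAf q hq (alphaAf q hq) ∈ boundary (psi q hq) 1 := by
    rw [← h]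
    exact Submodule.sub_mem _ (mul_thetaAf_mem_boundary _ alpha_sq_mem_boundary)
      (Submodule.smul_mem _ _ (thetaAf_mul_mem_boundary _ alpha_sq_mem_boundary))
  exact (Submodule.smul_mem_iff _ (one_sub_pow_ne_zero hq (by norm_num))).1 h1

/-- The boundary is a bimodule containing `α`, hence `αα* - q² α*α`, a nonzero scalar. -/
theorem one_mem_boundary : (1 : Calkin) ∈ boundary (psi q hq) 1 := by
  have h := congrArg (thetaAf q hq) (alpha_relation (q := q) (hq := hq))
  rw [map_sub, map_smul, map_smul, map_mul, map_mul, map_one] at h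
  have h1 : (1 - (q : ℂ) ^ 2) • (1 : Calkin) ∈ boundary (psi q hq) 1 := by
    rw [← h]
    exact Submodule.sub_mem _ (mul_thetaAf_mem_boundary _ alpha_mem_boundary)
      (Submodule.smul_mem _ _ (thetaAf_mul_mem_boundary _ alpha_mem_boundary))
  exact (Submodule.smul_mem_iff _ (one_sub_pow_ne_zero hq two_ne_zero)).1 h1

theorem thetaAf_mem_boundary (a : Af q hq) : thetaAf q hq a ∈ boundary (psi q hq) 1 := by
  rw [← mul_one (thetaAf q hq a)]
  exact thetaAf_mul_mem_boundary a one_mem_boundary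

set_option maxHeartbeats 1000000 in
-- Each term of the differential has two factors `F`, which cancel. The differential of the form
-- representing `F` thus has no component along `F`.
theorem exists_psi_delta_signForm :
    ∃ a, psi q hq (delta (signForm q hq)) = thetaAf q hq a := by
  have h1 : psi q hq (dgen (alphaAf q hq)) * psi q hq (dgen (star (alphaAf q hq))) =
      thetaAf q hq (-(alphaAf q hq * star (alphaAf q hq))) := by
    rw [psi_dgen_alpha, psi_dgen_star_alpha, neg_mul,
      mul_commute_mul theta_signOp_sq (theta_signOp_commute _), ← map_mul, ← map_neg]
  have h2 : psi q hq (dgen (star (alphaAf q hq))) * psi q hq (dgen (alphaAf q hq)) =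
      thetaAf q hq (-(star (alphaAf q hq) * alphaAf q hq)) := by
    rw [psi_dgen_alpha, psi_dgen_star_alpha, mul_neg,
      mul_commute_mul theta_signOp_sq (theta_signOp_commute _), ← map_mul, ← map_neg]
  refine ⟨(1 - (q : ℂ) ^ 2)⁻¹ • (-(alphaAf q hq * star (alphaAf q hq)) +
    (q : ℂ) ^ 2 • -(star (alphaAf q hq) * alphaAf q hq)), ?_⟩
  rw [map_smul, map_add, map_smul, ← h1, ← h2, ← map_mul (psi q hq),
    ← map_mul (psi q hq), ← delta_of_mul_dgen,
    ← delta_of_mul_dgen, ← map_smul (psi q hq), ← map_add (psi q hq), ← map_smul (psi q hq),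
    ← map_smul delta, ← map_add delta, ← map_smul delta, signForm]

theorem theta_signOp_commute_psi_dgen (a : Af q hq) :
    Commute (theta signOp) (psi q hq (dgen a)) := by
  obtain ⟨p, hp⟩ := exists_symbol_dgen a
  rw [hp]
  exact (((Commute.refl _).mul_right (theta_signOp_commute p.1))).add_right
    (theta_signOp_commute (p.2 : Af q hq))

set_option maxHeartbeats 1000000 in
-- Let `ω` be `signForm q hq`. Since `ψ(ω) = F` commutes with `a`, the form `aω - ωa` lies in the
-- kernel. Its differential is `a δω + δa ω - δω a + ω δa`; the terms with `δω` map into `θ(𝒜_f)`,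
-- and the other two agree under `ψ`.
theorem psi_dgen_mul_signOp_mem_boundary (a : Af q hq) :
    psi q hq (dgen a) * theta signOp ∈ boundary (psi q hq) 1 := by
  obtain ⟨d, hd⟩ := exists_psi_delta_signForm (q := q) (hq := hq)
  have hμ : of a * signForm q hq - signForm q hq * of a ∈ kerDeg (psi q hq) 1 := by
    refine mem_kerDeg.2 ⟨Submodule.sub_mem _ (of_mul_mem_deg _ signForm_mem_deg)
      (mul_of_mem_deg _ signForm_mem_deg), ?_⟩
    rw [map_sub, map_mul, map_mul, psi_of a, psi_signForm, (theta_signOp_commute a).eq, sub_self]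
  have h1 := mem_boundary.2 ⟨_, hμ, rfl⟩
  rw [map_sub, delta_of_mul, delta_mul_of a signForm_mem_deg, map_sub, map_add, map_sub,
    map_mul _ (of a), map_mul _ (dgen a), map_mul _ _ (of a), map_mul _ _ (dgen a), psi_of a, hd,
    psi_signForm, (theta_signOp_commute_psi_dgen a).eq, ← map_mul, ← map_mul] at h1
  -- Removing the part in `θ(𝒜_f)` leaves twice the desired element.
  have h2 := Submodule.sub_mem _ h1 (Submodule.sub_mem _ (thetaAf_mem_boundary (a * d))
    (thetaAf_mem_boundary (d * a)))
  refine (Submodule.smul_mem_iff _ (two_ne_zero (α := ℂ))).1 ?_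
  convert h2 using 1
  rw [two_smul]
  abel

theorem signOp_mul_mem_boundary {c : Af q hq} (hc : c ∈ idealBeta q hq) :
    theta signOp * thetaAf q hq c ∈ boundary (psi q hq) 1 := by
  induction hc using TwoSidedIdeal.span_induction with
  | mem x hx =>
    rw [(theta_signOp_commute x).eq]
    rcases hx with rfl | rfl
    · have := neg_mem (psi_dgen_mul_signOp_mem_boundary (betaAf q hq))
      rwa [psi_dgen_beta, neg_mul, neg_neg] at this
    · have := psi_dgen_mul_signOp_mem_boundary (star (betaAf q hq))
      rwa [psi_dgen_star_beta] at this
  | zero => rw [map_zero, mul_zero]; exact zero_mem _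
  | add x y _ _ hx hy => rw [map_add, mul_add]; exact add_mem hx hy
  | neg x _ hx => rw [map_neg, mul_neg]; exact neg_mem hx
  | left_absorb a x _ hx =>
    rw [map_mul, ← mul_assoc, (theta_signOp_commute a).eq, mul_assoc, ← psi_of]
    exact of_mul_mem_boundary a hx
  | right_absorb a x _ hx =>
    rw [map_mul, ← mul_assoc, ← psi_of a]
    exact mul_of_mem_boundary a hx

/-- In the product, the coefficient of `F` is `b c' + c b'`, which lies in `ℐ_β` because `c` and
`c'` do; the rest lies in `θ(𝒜_f)`. -/
theorem symbol_mul_symbol_mem_boundary (p r : Af q hq × idealBeta q hq) :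
    symbol q hq p * symbol q hq r ∈ boundary (psi q hq) 1 := by
  rw [symbol, symbol, add_mul_add_of_commute theta_signOp_sq (theta_signOp_commute _)
    (theta_signOp_commute _), ← map_mul, ← map_mul, ← map_mul, ← map_mul, ← map_add, ← map_add]
  exact Submodule.add_mem _ (thetaAf_mem_boundary _) (signOp_mul_mem_boundary
    ((idealBeta q hq).add_mem ((idealBeta q hq).mul_mem_left _ _ r.2.2)
      ((idealBeta q hq).mul_mem_right _ _ p.2.2)))

theorem psi_mem_boundary_of_deg_two {ω : UnivForms (Af q hq)} (hω : ω ∈ deg (Af q hq) 2) :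
    psi q hq ω ∈ boundary (psi q hq) 1 := by
  refine deg_succ_induction (P := fun ω => psi q hq ω ∈ boundary (psi q hq) 1) ?_ ?_ ?_ ?_ hω
  · rw [map_zero]; exact zero_mem _
  · intro x y hx hy; rw [map_add]; exact add_mem hx hy
  · intro c x hx; rw [map_smul]; exact Submodule.smul_mem _ _ hx
  · intro x hx a
    obtain ⟨p, hp⟩ := exists_symbol hx
    obtain ⟨r, hr⟩ := exists_symbol_dgen a
    rw [map_mul, hp, hr]
    exact symbol_mul_symbol_mem_boundary p r

end OneForms

end ConnesDeRham

theorem mainTheorem1 (q : ℝ) (hq0 : q ≠ 0) (hq1 : |q| < 1) :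
    (∃ Φ : OmegaD q hq1 1 ≃ₗ[Af q hq1] (Af q hq1 × idealBeta q hq1),
      (∀ (b : Af q hq1) (x : OmegaD q hq1 1),
        Φ (MulOpposite.op b • x) = MulOpposite.op b • Φ x) ∧
      ∀ ω : UnivForms.deg (Af q hq1) 1,
        psi q hq1 ω = theta signOp * theta ((Φ (Forms.mk (psi q hq1) 1 ω)).1 : Hilb →L[ℂ] Hilb) +
          theta (((Φ (Forms.mk (psi q hq1) 1 ω)).2 : Af q hq1) : Hilb →L[ℂ] Hilb)) ∧
    ∀ n : ℕ, 2 ≤ n → Subsingleton (OmegaD q hq1 n) := by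
  refine ⟨⟨oneFormsEquiv q hq1, classSymbol_op_smul,
    fun ω => (symbol_classSymbol ω).symm⟩, fun n hn => ?_⟩
  obtain ⟨m, rfl⟩ := Nat.exists_eq_add_of_le' hn
  exact subsingleton_forms fun ω hω =>
    mem_boundary_of_deg (fun ω h => psi_mem_boundary_of_deg_two h) m hω
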